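/- Let $(Z_n)_{n\ge 1}$ be i.i.d. copies of a real random variable $Z$ that is almost surely positive, not almost surely constant, and satisfies $\mathrm E[\log Z]<0$ (the value $-\infty$ is allowed) and $\mathrm E[Z^\delta]<+\infty$ for some $\delta>0$. For $\epsilon>0$ put $$M_{n,\epsilon}=\begin{pmatrix}1&\epsilon\\ \epsilon Z_n& Z_n\end{pmatrix},\qquad X_0=\sum_{n\ge 1}Z_1\cdots Z_n ,$$ and for real random variables write $X\preccurlyeq Y$ if $\mathrm P(X\ge t)\le \mathrm P(Y\ge t)$ for every $t\in\mathbf R$. The series $X_0$ converges almost surely, and for every $\epsilon>0$ the following hold. 1. There is a nonnegative random variable $X_\epsilon$, unique in distribution, such that $$X_\epsilon\overset{(d)}{=}Z\,\frac{1+X_\epsilon}{1+\epsilon^2X_\epsilon},\qquad Z\text{ independent of }X_\epsilon .$$ 2. $X_\epsilon\preccurlyeq X_0$, and if $\epsilon\le 1$ then also $Z\preccurlyeq X_\epsilon$. 3. $\log(1+\epsilon^2X_\epsilon)$ is integrable and, for any norm on the $2\times2$ real matrices, the limit $L(\epsilon)=\lim_{n\to\infty}\frac1n\log\|M_{n,\epsilon}\cdots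 M_{1,\epsilon}\|$ exists almost surely and equals $$L(\epsilon)=\mathrm E[\log(1+\epsilon^2X_\epsilon)].$$ 4. For all nonzero vectors $x=(x_1,x_2)$ and $y$ in $\mathbf R^2$ with nonnegative entries such that $x_1>0$ or $\mathrm E|\log Z|<\infty$, $$\frac1n\log\langle x,M_{n,\epsilon}\cdots M_{1,\epsilon}\,y\rangle\longrightarrow L(\epsilon)\qquad\text{almost surely and in }L^1\text{ as }n\to\infty .$$ -/

import Mathlib

open MeasureTheory ProbabilityTheory Filter Topology

noncomputable section

namespace RandomMatrix

/-- The matrix with rows `(1, ε)` and `(ε z, z)`. -/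
def mat (ε z : ℝ) : Matrix (Fin 2) (Fin 2) ℝ :=
  !![1, ε; ε * z, z]

/-- For a sequence `z 0, z 1, …` (standing for `Z_1, Z_2, …`), the product
`M_n ⋯ M_1`, the newest factor on the left. -/
def matProd (ε : ℝ) (z : ℕ → ℝ) : ℕ → Matrix (Fin 2) (Fin 2) ℝ
  | 0 => 1
  | n + 1 => mat ε (z n) * matProd ε z n

/-- The series `X_0 = ∑_{n ≥ 1} Z_1 ⋯ Z_n`, where `z k` stands for `Z_{k+1}`. -/
def X0 (z : ℕ → ℝ) : ℝ :=
  ∑' n : ℕ, ∏ k ∈ Finset.range (n + 1), z k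

/-- Stochastic dominance `X ≼ Y`, in terms of the laws of `X` and `Y`:
`P(X ≥ x) ≤ P(Y ≥ x)` for every real `x`. -/
def StochDom (lawX lawY : Measure ℝ) : Prop :=
  ∀ x : ℝ, lawX (Set.Ici x) ≤ lawY (Set.Ici x)

/-- `ν` is the law of a nonnegative random variable `X` that has the same law as
`Z (1 + X) / (1 + ε² X)`, where `Z` has law `μ` and is independent of `X`. -/
structure IsInvariantLaw (μ : Measure ℝ) (ε : ℝ) (ν : Measure ℝ) : Prop where
  prob : IsProbabilityMeasure ν
  nonneg : ∀ᵐ x ∂ν, 0 ≤ x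
  invariant : (μ.prod ν).map (fun p : ℝ × ℝ => p.1 * ((1 + p.2) / (1 + ε ^ 2 * p.2))) = ν

/-- The standing assumptions on a real random variable `Z` on `(Ω, P)`. -/
structure Assumptions {Ω : Type*} [MeasurableSpace Ω] (P : Measure Ω) (Z : Ω → ℝ) : Prop where
  pos : ∀ᵐ ω ∂P, 0 < Z ω
  nondeterministic : ∀ c : ℝ, ¬ ∀ᵐ ω ∂P, Z ω = c
  /-- `E[log Z] < 0`, the value `-∞` being allowed: `E[log⁺ Z] < E[log⁻ Z]` in `[0, ∞]`. -/
  log_neg : ∫⁻ ω, ENNReal.ofReal (Real.log (Z ω)) ∂P < ∫⁻ ω, ENNReal.ofReal (-Real.log (Z ω)) ∂P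
  moment : ∃ δ : ℝ, 0 < δ ∧ ∫⁻ ω, ENNReal.ofReal (Z ω ^ δ) ∂P < ⊤

/-- `L` is the Lyapunov exponent of the products `M_n ⋯ M_1`: almost surely
`(1/n) log ‖M_n ⋯ M_1‖ → L`, whatever the norm on the space of `2 × 2` matrices. -/
def IsLyapunovExponent {Ω : Type*} [MeasurableSpace Ω] (P : Measure Ω) (Z : ℕ → Ω → ℝ)
    (ε L : ℝ) : Prop :=
  ∀ N : Seminorm ℝ (Matrix (Fin 2) (Fin 2) ℝ), (∀ A, N A = 0 → A = 0) →
    ∀ᵐ ω ∂P, Tendsto (fun n : ℕ => (1 / (n : ℝ)) * Real.log (N (matProd ε (fun k => Z k ω) n)))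
      atTop (𝓝 L)

/-- `(1/n) log ⟨x, M_n ⋯ M_1 y⟩`. -/
def growth (ε : ℝ) (x y : Fin 2 → ℝ) (z : ℕ → ℝ) (n : ℕ) : ℝ :=
  (1 / (n : ℝ)) * Real.log (x ⬝ᵥ (matProd ε z n).mulVec y)

end RandomMatrix

end

/-! In the coordinate t = log x the recursion X ↦ Z(1 + X)/(1 + ε²X) becomes t ↦ log Z + φ(t), with
φ = `logMap ε`. This φ is bounded by |log ε²|, and |φ'| ≤ |1 - ε|/(1 + ε) < 1. Two orbits driven by
the same noise are thus within a constant of each other after one step and then merge geometrically,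
whatever the noise and the starting points. Hence the backward compositions converge for every noise
sequence (`tendsto_backward`), their limit has a stationary law (`isStationary_backwardLim`), and
there is no other one (`stationary_unique`).

The matrix sends (1, εeᵗ) to (1 + ε²eᵗ)(1, εeˢ), where s is the next point of the orbit
(`matProd_mulVec_base`). So the logarithmic growth is a Birkhoff sum of ψ(t) = log(1 + ε²eᵗ) along
an orbit. For the ergodic theorem (`ae_tendsto_average`), ψ at a given time is replaced by a
function of a window of recent noises. Windows far apart are independent, so the strong law applies,
and the error is geometrically small in the window length. Scheffé's lemma adds convergence in L¹.
Changing the vectors costs a bounded amount plus a function of the last log Z_n, which is o(n);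
changing the norm costs a bounded amount.

The comparisons are pathwise, with X_ε realised as the exponential of the backward limit: unrolling
x_n ≤ z_n(1 + x_{n+1}) gives X_ε ≤ X_0, and φ ≥ 0 for ε ≤ 1 gives Z ≤ X_ε. The series X_0 converges
by the strong law for log Z truncated from below. -/

noncomputable section

namespace RandomMatrix

/-! ### Bounded contractions: forward orbits and backward compositions -/

/-- `φ` is bounded by `B` and a contraction of ratio `c < 1`. -/
structure BoundedContraction (φ : ℝ → ℝ) (c B : ℝ) : Prop where
  nonneg : 0 ≤ c
  lt_one : c < 1
  lip : ∀ s t, |φ s - φ t| ≤ c * |s - t|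
  bound : ∀ t, |φ t| ≤ B

/-- The orbit `t ↦ l n + φ t` started at `s`. -/
def orbit (φ : ℝ → ℝ) (l : ℕ → ℝ) (s : ℝ) : ℕ → ℝ
  | 0 => s
  | n + 1 => l n + φ (orbit φ l s n)

/-- The composition of the first `n` maps `t ↦ l k + φ t`, the first one being applied last,
evaluated at `0`. -/
def backward (φ : ℝ → ℝ) : ℕ → (ℕ → ℝ) → ℝ
  | 0, _ => 0
  | n + 1, l => l 0 + φ (backward φ n (fun k => l (k + 1)))

/-- The limit of the backward compositions. -/
def backwardLim (φ : ℝ → ℝ) (l : ℕ → ℝ) : ℝ :=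
  limUnder atTop (fun n => backward φ n l)

namespace BoundedContraction

variable {φ : ℝ → ℝ} {c B : ℝ}

theorem continuous (h : BoundedContraction φ c B) : Continuous φ := by
  have : LipschitzWith ⟨c, h.nonneg⟩ φ :=
    LipschitzWith.of_dist_le_mul fun x y => by
      rw [Real.dist_eq, Real.dist_eq]; exact h.lip x y
  exact this.continuous

theorem measurable (h : BoundedContraction φ c B) : Measurable φ := h.continuous.measurable

theorem abs_sub_le_two_mul (h : BoundedContraction φ c B) (s t : ℝ) : |φ s - φ t| ≤ 2 * B := by
  have h1 := abs_le.1 (h.bound s)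
  have h2 := abs_le.1 (h.bound t)
  rw [abs_le]; constructor <;> linarith

/-- Boundedness of φ brings any two orbits within `2 * B` after one step, and contraction does the
rest. Uniformity in the starting points is what makes moment assumptions on initial laws
unnecessary. -/
theorem orbit_dist (h : BoundedContraction φ c B) (l : ℕ → ℝ) (s t : ℝ) (n : ℕ) :
    |orbit φ l s (n + 1) - orbit φ l t (n + 1)| ≤ 2 * B * c ^ n := by
  induction n with
  | zero => simpa [orbit] using h.abs_sub_le_two_mul s t
  | succ n ih =>
    have e : orbit φ l s (n + 1 + 1) - orbit φ l t (n + 1 + 1)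
        = φ (orbit φ l s (n + 1)) - φ (orbit φ l t (n + 1)) := by
      rw [orbit, orbit.eq_2 φ l t]; ring
    rw [e]
    calc _ ≤ c * |orbit φ l s (n + 1) - orbit φ l t (n + 1)| := h.lip _ _
      _ ≤ c * (2 * B * c ^ n) := mul_le_mul_of_nonneg_left ih h.nonneg
      _ = _ := by ring

/-- The two compositions differ only in their innermost argument, and every outer map contracts. The
index starts at `n + 1` because the first composition differs from 0 by an amount that involves the
unbounded `l 0`. -/
theorem backward_dist (h : BoundedContraction φ c B) (l : ℕ → ℝ) (n : ℕ) :
    |backward φ (n + 1) l - backward φ (n + 2) l| ≤ 2 * B * c ^ n := by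
  induction n generalizing l with
  | zero => simpa [backward] using h.abs_sub_le_two_mul _ _
  | succ n ih =>
    have e : backward φ (n + 1 + 1) l - backward φ (n + 1 + 2) l
        = φ (backward φ (n + 1) fun k => l (k + 1))
          - φ (backward φ (n + 2) fun k => l (k + 1)) := by
      rw [backward, backward.eq_2 φ l (n + 2)]; ring
    rw [e]
    calc _ ≤ _ := h.lip _ _
      _ ≤ c * (2 * B * c ^ n) := mul_le_mul_of_nonneg_left (ih _) h.nonneg
      _ = _ := by ring

theorem tendsto_backward (h : BoundedContraction φ c B) (l : ℕ → ℝ) :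
    Tendsto (fun n => backward φ n l) atTop (𝓝 (backwardLim φ l)) := by
  have hc : CauchySeq (fun n => backward φ (n + 1) l) :=
    cauchySeq_of_le_geometric c (2 * B) h.lt_one fun n => by
      simpa [Real.dist_eq] using h.backward_dist l n
  obtain ⟨a, ha⟩ := cauchySeq_tendsto_of_complete hc
  exact tendsto_nhds_limUnder ⟨a, (tendsto_add_atTop_iff_nat 1).1 ha⟩

theorem backwardLim_eq (h : BoundedContraction φ c B) (l : ℕ → ℝ) :
    backwardLim φ l = l 0 + φ (backwardLim φ fun k => l (k + 1)) := by
  have h1 := (tendsto_add_atTop_iff_nat 1).2 (h.tendsto_backward l)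
  have h2 : Tendsto (fun n => backward φ (n + 1) l) atTop
      (𝓝 (l 0 + φ (backwardLim φ fun k => l (k + 1)))) := by
    simp only [backward]
    exact tendsto_const_nhds.add
      ((h.continuous.tendsto _).comp (h.tendsto_backward fun k => l (k + 1)))
  exact tendsto_nhds_unique h1 h2

theorem measurable_backward (h : BoundedContraction φ c B) (n : ℕ) :
    Measurable (backward φ n) := by
  induction n with
  | zero => exact measurable_const
  | succ n ih =>
    have : Measurable fun l : ℕ → ℝ => fun k => l (k + 1) := by fun_prop
    exact (measurable_pi_apply 0).add (h.measurable.comp (ih.comp this))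

theorem measurable_backwardLim (h : BoundedContraction φ c B) : Measurable (backwardLim φ) :=
  measurable_of_tendsto_metrizable h.measurable_backward
    (tendsto_pi_nhds.2 fun l => h.tendsto_backward l)

theorem measurable_orbit (h : BoundedContraction φ c B) (n : ℕ) :
    Measurable fun p : (ℕ → ℝ) × ℝ => orbit φ p.1 p.2 n := by
  induction n with
  | zero => exact measurable_snd
  | succ n ih =>
    exact ((measurable_pi_apply n).comp measurable_fst).add (h.measurable.comp ih)

end BoundedContraction

theorem orbit_congr {φ : ℝ → ℝ} {l l' : ℕ → ℝ} (s : ℝ) {n : ℕ} (h : ∀ k < n, l k = l' k) :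
    orbit φ l s n = orbit φ l' s n := by
  induction n with
  | zero => rfl
  | succ n ih =>
    rw [orbit, orbit, h n n.lt_succ_self, ih fun k hk => h k (hk.trans n.lt_succ_self)]

theorem orbit_add (φ : ℝ → ℝ) (l : ℕ → ℝ) (s : ℝ) (n m : ℕ) :
    orbit φ l s (n + m) = orbit φ (fun k => l (n + k)) (orbit φ l s n) m := by
  induction m with
  | zero => rfl
  | succ m ih => rw [← add_assoc, orbit, orbit, ih]

/-! ### Averages along residue classes -/

theorem sum_range_mul_block (f : ℕ → ℝ) (m N : ℕ) :
    ∑ k ∈ Finset.range (N * m), f k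
      = ∑ j ∈ Finset.range m, ∑ i ∈ Finset.range N, f (i * m + j) := by
  induction N with
  | zero => simp
  | succ N ih =>
    rw [Nat.succ_mul, Finset.sum_range_add, ih, ← Finset.sum_add_distrib]
    exact Finset.sum_congr rfl fun j _ => (Finset.sum_range_succ _ _).symm

/-- The averages of a nonnegative sequence converge as soon as the averages along
each residue class modulo `m` do. -/
theorem tendsto_average_of_residues {f : ℕ → ℝ} (hf : ∀ k, 0 ≤ f k) {m : ℕ} (hm : 0 < m) {a : ℝ}
    (h : ∀ j < m, Tendsto (fun N : ℕ => (∑ i ∈ Finset.range N, f (i * m + j)) / N) atTop (𝓝 a)) :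
    Tendsto (fun n : ℕ => (∑ k ∈ Finset.range n, f k) / n) atTop (𝓝 a) := by
  have hm' : (0 : ℝ) < m := by exact_mod_cast hm
  have h1 : Tendsto (fun N : ℕ => (∑ k ∈ Finset.range (N * m), f k) / N) atTop (𝓝 (m * a)) := by
    have := tendsto_finsetSum (Finset.range m) fun j hj => h j (Finset.mem_range.1 hj)
    simp only [Finset.sum_const, Finset.card_range, nsmul_eq_mul] at this
    refine this.congr fun N => ?_
    rw [sum_range_mul_block, Finset.sum_div]
  have hdiv : Tendsto (fun n : ℕ => n / m) atTop atTop := Nat.tendsto_div_const_atTop hm.ne'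
  have hr : Tendsto (fun n : ℕ => ((n / m : ℕ) : ℝ) / n) atTop (𝓝 (1 / m)) := by
    have h0 : Tendsto (fun n : ℕ => (1 : ℝ) / n) atTop (𝓝 0) := tendsto_one_div_atTop_nhds_zero_nat
    have hl : Tendsto (fun n : ℕ => 1 / (m : ℝ) - 1 / n) atTop (𝓝 (1 / m)) := by
      simpa using tendsto_const_nhds.sub h0
    refine tendsto_of_tendsto_of_tendsto_of_le_of_le' hl tendsto_const_nhds ?_ ?_
    · filter_upwards [eventually_gt_atTop 0] with n hn
      have hn' : (0 : ℝ) < n := by exact_mod_cast hn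
      have : (n : ℝ) ≤ m * ((n / m : ℕ) : ℝ) + m := by
        have := Nat.div_add_mod n m
        have h2 := Nat.mod_lt n hm
        exact_mod_cast (by omega : n ≤ m * (n / m) + m)
      rw [div_sub_div _ _ hm'.ne' hn'.ne', div_le_div_iff₀ (by positivity) hn']
      nlinarith
    · filter_upwards [eventually_gt_atTop 0] with n hn
      have hn' : (0 : ℝ) < n := by exact_mod_cast hn
      rw [div_le_div_iff₀ hn' hm']
      have := Nat.div_mul_le_self n m
      rw [one_mul]; exact_mod_cast this
  have hr' : Tendsto (fun n : ℕ => ((n / m + 1 : ℕ) : ℝ) / n) atTop (𝓝 (1 / m)) := by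
    have := hr.add (tendsto_one_div_atTop_nhds_zero_nat (𝕜 := ℝ))
    rw [add_zero] at this
    refine this.congr fun n => ?_
    push_cast; ring
  have hmono : Monotone fun n => ∑ k ∈ Finset.range n, f k := fun i j hij =>
    Finset.sum_le_sum_of_subset_of_nonneg (Finset.range_mono hij) fun k _ _ => hf k
  have e : (m : ℝ) * a * (1 / m) = a := by field_simp
  -- Partial sums increase, so the sum up to n lies between those up to the neighbouring multiples
  -- of m; `n / m` is the integer quotient.
  have hlow := (h1.comp hdiv).mul hr
  have hup := (h1.comp ((tendsto_add_atTop_nat 1).comp hdiv)).mul hr'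
  rw [e] at hlow hup
  refine tendsto_of_tendsto_of_tendsto_of_le_of_le' hlow hup ?_ ?_
  · filter_upwards [hdiv.eventually_gt_atTop 0, eventually_gt_atTop 0] with n hn hn0
    have hn' : ((n / m : ℕ) : ℝ) ≠ 0 := by exact_mod_cast hn.ne'
    simp only [Function.comp]
    rw [div_mul_div_cancel₀ hn']
    exact div_le_div_of_nonneg_right (hmono (Nat.div_mul_le_self n m)) (Nat.cast_nonneg n)
  · filter_upwards with n
    have hn' : ((n / m + 1 : ℕ) : ℝ) ≠ 0 := by exact_mod_cast Nat.succ_ne_zero (n / m)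
    simp only [Function.comp]
    rw [div_mul_div_cancel₀ hn']
    refine div_le_div_of_nonneg_right (hmono ?_) (Nat.cast_nonneg n)
    have := Nat.div_add_mod n m
    have h2 := Nat.mod_lt n hm
    rw [add_mul, one_mul, mul_comm]; omega

/-! ### Independent sequences and functions of finitely many coordinates -/

/-- A sequence of independent, identically distributed real random variables. -/
structure IsIIDSeq {Ω : Type*} [MeasurableSpace Ω] (P : Measure Ω) (L : ℕ → Ω → ℝ) : Prop where
  measurable : ∀ n, Measurable (L n)
  indep : iIndepFun L P
  ident : ∀ n, IdentDistrib (L n) (L 0) P P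

/-- `ρ` is invariant under `t ↦ l + φ t`, where `l` has law `μ`. -/
def IsStationary (μ : Measure ℝ) (φ : ℝ → ℝ) (ρ : Measure ℝ) : Prop :=
  (μ.prod ρ).map (fun p : ℝ × ℝ => p.1 + φ p.2) = ρ

section

variable {Ω : Type*} [MeasurableSpace Ω] {P : Measure Ω}
  {L : ℕ → Ω → ℝ}

theorem IsIIDSeq.measurable_seq (hL : IsIIDSeq P L) (n : ℕ) :
    Measurable fun ω k => L (n + k) ω :=
  measurable_pi_iff.2 fun k => hL.measurable (n + k)

theorem IsIIDSeq.measurable_seq_zero (hL : IsIIDSeq P L) :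
    Measurable fun ω k => L k ω :=
  measurable_pi_iff.2 fun k => hL.measurable k

theorem IsIIDSeq.map_shift [IsProbabilityMeasure P] (hL : IsIIDSeq P L) (n : ℕ) :
    P.map (fun ω k => L (n + k) ω) = P.map (fun ω k => L k ω) := by
  have h : iIndepFun (fun k => L (n + k)) P :=
    hL.indep.precomp (g := fun k => n + k) (fun a b hab => by simpa using hab)
  rw [h.map_fun_eq_infinitePi_map fun k => hL.measurable _,
    hL.indep.map_fun_eq_infinitePi_map hL.measurable]
  congr 1
  funext k
  rw [(hL.ident (n + k)).map_eq, (hL.ident k).map_eq]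

theorem IsIIDSeq.identDistrib_shift [IsProbabilityMeasure P] (hL : IsIIDSeq P L) (n : ℕ)
    {f : (ℕ → ℝ) → ℝ}
    (hf : Measurable f) :
    IdentDistrib (fun ω => f fun k => L (n + k) ω) (fun ω => f fun k => L k ω) P P :=
  (IdentDistrib.mk (hL.measurable_seq n).aemeasurable hL.measurable_seq_zero.aemeasurable
    (hL.map_shift n)).comp hf

theorem IsIIDSeq.indepFun_of_dependsOn (hL : IsIIDSeq P L) {f g : (ℕ → ℝ) → ℝ}
    (hf : Measurable f) (hg : Measurable g) {S T : Set ℕ} (hfS : DependsOn f S)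
    (hgT : DependsOn g T) (hST : Disjoint S T) :
    IndepFun (fun ω => f fun k => L k ω) (fun ω => g fun k => L k ω) P := by
  have key : ∀ (F : (ℕ → ℝ) → ℝ) (U : Set ℕ), Measurable F → DependsOn F U →
      MeasurableSpace.comap (fun ω => F fun k => L k ω) inferInstance
        ≤ ⨆ i ∈ U, MeasurableSpace.comap (L i) inferInstance := by
    classical
    intro F U hF hU
    rw [← measurable_iff_comap_le]
    -- Setting the coordinates outside `U` to 0 does not change `F`, and the truncated sequence is
    -- measurable for the σ-algebra of the `L i` with `i ∈ U`.
    have e : (fun ω => F fun k => L k ω) = F ∘ fun ω k => if k ∈ U then L k ω else 0 := by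
      funext ω
      exact hU fun i hi => by simp [hi]
    rw [e]
    refine @Measurable.comp _ _ _ (_) _ _ _ _ hF ((@measurable_pi_iff _ _ _ (_) _ _).2 fun k => ?_)
    by_cases hk : k ∈ U
    · simp only [hk, if_true]
      exact (comap_measurable (L k)).mono (le_iSup₂_of_le k hk le_rfl) le_rfl
    · simp only [hk, if_false]
      exact measurable_const
  rw [IndepFun_iff_Indep]
  exact indep_of_indep_of_le
    (indep_iSup_of_disjoint (fun i => (hL.measurable i).comap_le) hL.indep.iIndep hST)
    (key f S hf hfS) (key g T hg hgT)

/-- The strong law of large numbers for nonnegative identically distributed variables which are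
independent as soon as their indices are at distance at least `m`. -/
theorem strong_law_of_finite_range {Y : ℕ → Ω → ℝ} (hY0 : ∀ k ω, 0 ≤ Y k ω)
    (hint : Integrable (Y 0) P) (hident : ∀ k, IdentDistrib (Y k) (Y 0) P P) {m : ℕ} (hm : 0 < m)
    (hindep : ∀ k k', k + m ≤ k' → IndepFun (Y k) (Y k') P) :
    ∀ᵐ ω ∂P, Tendsto (fun n : ℕ => (∑ k ∈ Finset.range n, Y k ω) / n) atTop
      (𝓝 (∫ ω, Y 0 ω ∂P)) := by
  have h : ∀ j, ∀ᵐ ω ∂P, Tendsto (fun N : ℕ => (∑ i ∈ Finset.range N, Y (i * m + j) ω) / N) atTop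
      (𝓝 (∫ ω, Y 0 ω ∂P)) := by
    intro j
    have := strong_law_ae_real (fun i => Y (i * m + j))
      ((hident _).integrable_iff.2 hint) (fun i i' hii => ?_)
      (fun i => (hident _).trans (hident _).symm)
    · rwa [(hident (0 * m + j)).integral_eq] at this
    · have key : ∀ a b : ℕ, a < b → IndepFun (Y (a * m + j)) (Y (b * m + j)) P := by
        intro a b hab
        refine hindep _ _ ?_
        have := Nat.mul_le_mul_right m (Nat.succ_le_of_lt hab)
        rw [Nat.succ_mul] at this
        omega
      rcases lt_or_gt_of_ne hii with h | h
      · exact key _ _ h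
      · exact (key _ _ h).symm
  filter_upwards [ae_all_iff.2 h] with ω hω
  exact tendsto_average_of_residues (fun k => hY0 k ω) hm fun j _ => hω j

variable {φ : ℝ → ℝ} {c B : ℝ}

theorem BoundedContraction.measurable_orbit_left (h : BoundedContraction φ c B) (s : ℝ) (n : ℕ) :
    Measurable fun l : ℕ → ℝ => orbit φ l s n :=
  (h.measurable_orbit n).comp (measurable_id.prodMk measurable_const)

theorem dependsOn_orbit_shift (φ : ℝ → ℝ) (s : ℝ) (k m : ℕ) :
    DependsOn (fun l : ℕ → ℝ => orbit φ (fun i => l (k + i)) s m) (Set.Ico k (k + m)) :=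
  fun _ _ h => orbit_congr s fun i hi => h (k + i) ⟨by omega, by omega⟩

theorem IsIIDSeq.indepFun_orbit (hL : IsIIDSeq P L) (h : BoundedContraction φ c B) (s : ℝ)
    (m : ℕ) : IndepFun (L m) (fun ω => orbit φ (fun k => L k ω) s m) P := by
  refine hL.indepFun_of_dependsOn (f := fun l => l m) (S := {m}) (T := Set.Ico 0 (0 + m))
    (measurable_pi_apply m) (h.measurable_orbit_left s m) (fun x y hxy => hxy m rfl) ?_ ?_
  · simpa using dependsOn_orbit_shift φ s 0 m
  · simp

/-! ### Stationary laws: geometric convergence, uniqueness, existence -/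

variable [IsProbabilityMeasure P]

/-- An orbit started at an independent point with a stationary law has this law at all times. -/
theorem IsIIDSeq.lintegral_orbit (hL : IsIIDSeq P L) (h : BoundedContraction φ c B)
    {ρ : Measure ℝ} [IsProbabilityMeasure ρ] (hρ : IsStationary (P.map (L 0)) φ ρ) (m : ℕ)
    {f : ℝ → ENNReal} (hf : Measurable f) :
    ∫⁻ s, ∫⁻ ω, f (orbit φ (fun k => L k ω) s m) ∂P ∂ρ = ∫⁻ t, f t ∂ρ := by
  have : IsProbabilityMeasure (P.map (L 0)) :=
    Measure.isProbabilityMeasure_map (hL.measurable 0).aemeasurable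
  induction m generalizing f with
  | zero => simp [orbit]
  | succ m ih =>
    have hmo : Measurable fun p : ℝ × Ω => orbit φ (fun k => L k p.2) p.1 m :=
      (h.measurable_orbit m).comp
        ((hL.measurable_seq_zero.comp measurable_snd).prodMk measurable_fst)
    have hF : Measurable fun p : ℝ × ℝ => f (p.1 + φ p.2) :=
      hf.comp (measurable_fst.add (h.measurable.comp measurable_snd))
    -- The noise `L m` is independent of the orbit up to time m, so it can be integrated separately.
    have step : ∀ s, ∫⁻ ω, f (orbit φ (fun k => L k ω) s (m + 1)) ∂P
        = ∫⁻ l, ∫⁻ ω, f (l + φ (orbit φ (fun k => L k ω) s m)) ∂P ∂(P.map (L 0)) := by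
      intro s
      have hms : Measurable fun ω => orbit φ (fun k => L k ω) s m :=
        (h.measurable_orbit_left s m).comp hL.measurable_seq_zero
      have hp := (indepFun_iff_map_prod_eq_prod_map_map (hL.measurable m).aemeasurable
        hms.aemeasurable).1 (hL.indepFun_orbit h s m)
      rw [(hL.ident m).map_eq] at hp
      have := Measure.isProbabilityMeasure_map hms.aemeasurable (μ := P)
      calc ∫⁻ ω, f (orbit φ (fun k => L k ω) s (m + 1)) ∂P
          = ∫⁻ p, f (p.1 + φ p.2)
              ∂(P.map fun ω => (L m ω, orbit φ (fun k => L k ω) s m)) := by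
            rw [lintegral_map hF ((hL.measurable m).prodMk hms)]; rfl
        _ = ∫⁻ l, ∫⁻ t, f (l + φ t) ∂(P.map fun ω => orbit φ (fun k => L k ω) s m)
              ∂(P.map (L 0)) := by
            rw [hp, lintegral_prod _ hF.aemeasurable]
        _ = _ := by
            refine lintegral_congr fun l => ?_
            exact lintegral_map (hF.comp (measurable_const.prodMk measurable_id)) hms
    simp only [step]
    rw [lintegral_lintegral_swap]
    · have e : ∀ l, ∫⁻ s, ∫⁻ ω, f (l + φ (orbit φ (fun k => L k ω) s m)) ∂P ∂ρ
          = ∫⁻ t, f (l + φ t) ∂ρ :=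
        fun l => ih (hF.comp (measurable_const.prodMk measurable_id))
      simp only [e]
      rw [← lintegral_prod (fun p : ℝ × ℝ => f (p.1 + φ p.2)) hF.aemeasurable]
      conv_rhs => rw [← hρ]
      exact (lintegral_map hf (measurable_fst.add (h.measurable.comp measurable_snd))).symm
    · have hG : Measurable fun q : (ℝ × ℝ) × Ω =>
          f (q.1.2 + φ (orbit φ (fun k => L k q.2) q.1.1 m)) :=
        hF.comp ((measurable_snd.comp measurable_fst).prodMk
          (hmo.comp ((measurable_fst.comp measurable_fst).prodMk measurable_snd)))
      exact (hG.lintegral_prod_right').aemeasurable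

theorem IsIIDSeq.map_orbit (hL : IsIIDSeq P L) (h : BoundedContraction φ c B)
    {ρ : Measure ℝ} [IsProbabilityMeasure ρ] (hρ : IsStationary (P.map (L 0)) φ ρ) (m : ℕ) :
    (ρ.prod P).map (fun p => orbit φ (fun k => L k p.2) p.1 m) = ρ := by
  have hmo : Measurable fun p : ℝ × Ω => orbit φ (fun k => L k p.2) p.1 m :=
    (h.measurable_orbit m).comp
      ((hL.measurable_seq_zero.comp measurable_snd).prodMk measurable_fst)
  refine Measure.ext_of_lintegral _ fun f hf => ?_
  rw [lintegral_map hf hmo]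
  exact (lintegral_prod _ (hf.comp hmo).aemeasurable).trans (hL.lintegral_orbit h hρ m hf)

/-- The law of an orbit converges geometrically to any stationary law. -/
theorem IsIIDSeq.abs_integral_sub_le (hL : IsIIDSeq P L) (h : BoundedContraction φ c B)
    {ρ : Measure ℝ} [IsProbabilityMeasure ρ] (hρ : IsStationary (P.map (L 0)) φ ρ) (m : ℕ)
    {f : ℝ → ℝ} {K : ℝ} (hK : 0 ≤ K) (hfm : Measurable f) (hfK : ∀ s t, |f s - f t| ≤ K * |s - t|)
    (hfρ : Integrable f ρ)
    (hfo : Integrable (fun ω => f (orbit φ (fun k => L k ω) 0 (m + 1))) P) :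
    |∫ t, f t ∂ρ - ∫ ω, f (orbit φ (fun k => L k ω) 0 (m + 1)) ∂P| ≤ K * (2 * B * c ^ m) := by
  have hmo : Measurable fun p : ℝ × Ω => orbit φ (fun k => L k p.2) p.1 (m + 1) :=
    (h.measurable_orbit (m + 1)).comp
      ((hL.measurable_seq_zero.comp measurable_snd).prodMk measurable_fst)
  have hmap := hL.map_orbit h hρ (m + 1)
  have i1 : Integrable (fun p : ℝ × Ω => f (orbit φ (fun k => L k p.2) p.1 (m + 1)))
      (ρ.prod P) := by
    rw [← hmap] at hfρ
    exact (integrable_map_measure hfm.aestronglyMeasurable hmo.aemeasurable).1 hfρ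
  have i2 : Integrable (fun p : ℝ × Ω => f (orbit φ (fun k => L k p.2) 0 (m + 1)))
      (ρ.prod P) := hfo.comp_snd ρ
  -- Coupling: an orbit with stationary starting point and the orbit of 0 are driven by the same
  -- noise on the product space.
  have e1 : ∫ t, f t ∂ρ
      = ∫ p, f (orbit φ (fun k => L k p.2) p.1 (m + 1)) ∂(ρ.prod P) := by
    conv_lhs => rw [← hmap]
    exact integral_map hmo.aemeasurable hfm.aestronglyMeasurable
  have e2 : ∫ ω, f (orbit φ (fun k => L k ω) 0 (m + 1)) ∂P
      = ∫ p : ℝ × Ω, f (orbit φ (fun k => L k p.2) 0 (m + 1)) ∂(ρ.prod P) := by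
    rw [integral_prod _ i2]; simp
  rw [e1, e2, ← integral_sub i1 i2, ← Real.norm_eq_abs]
  refine (norm_integral_le_of_norm_le_const (C := K * (2 * B * c ^ m))
    (Eventually.of_forall fun p => ?_)).trans (by simp)
  rw [Real.norm_eq_abs]
  exact (hfK _ _).trans (mul_le_mul_of_nonneg_left (h.orbit_dist _ _ _ _) hK)

theorem BoundedContraction.tendsto_error (h : BoundedContraction φ c B) (K : ℝ) :
    Tendsto (fun m : ℕ => K * (2 * B * c ^ m)) atTop (𝓝 0) := by
  have := (tendsto_pow_atTop_nhds_zero_of_lt_one h.nonneg h.lt_one).const_mul (K * (2 * B))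
  simpa [mul_assoc] using this

/-- The laws of the orbit of 0 converge weakly to every stationary law, as tested on bounded
Lipschitz functions, and weak limits are unique. -/
theorem IsIIDSeq.stationary_unique (hL : IsIIDSeq P L) (h : BoundedContraction φ c B)
    {ρ ρ' : Measure ℝ} [IsProbabilityMeasure ρ] [IsProbabilityMeasure ρ']
    (hρ : IsStationary (P.map (L 0)) φ ρ) (hρ' : IsStationary (P.map (L 0)) φ ρ') : ρ = ρ' := by
  have key : ∀ f : ℝ → ℝ, (∃ C : ℝ, ∀ x y, dist (f x) (f y) ≤ C) → (∃ K, LipschitzWith K f) →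
      ∫ t, f t ∂ρ = ∫ t, f t ∂ρ' := by
    rintro f ⟨C, hC⟩ ⟨K, hK⟩
    have hfm : Measurable f := hK.continuous.measurable
    have hb : ∀ x, ‖f x‖ ≤ C + |f 0| := fun x => by
      have h1 := hC x 0
      rw [Real.dist_eq] at h1
      have h2 := abs_sub_abs_le_abs_sub (f x) (f 0)
      rw [Real.norm_eq_abs]; linarith
    have hfK : ∀ s t, |f s - f t| ≤ K * |s - t| := fun s t => by
      simpa [Real.dist_eq] using hK.dist_le_mul s t
    have hint : ∀ σ : Measure ℝ, IsProbabilityMeasure σ → Integrable f σ := fun σ _ =>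
      Integrable.of_bound hfm.aestronglyMeasurable _ (Eventually.of_forall hb)
    have hto : ∀ σ : Measure ℝ, IsProbabilityMeasure σ → IsStationary (P.map (L 0)) φ σ →
        Tendsto (fun m => ∫ ω, f (orbit φ (fun k => L k ω) 0 (m + 1)) ∂P) atTop
          (𝓝 (∫ t, f t ∂σ)) := by
      intro σ _ hσ
      rw [tendsto_iff_dist_tendsto_zero]
      refine squeeze_zero (fun _ => dist_nonneg) (fun m => ?_) (h.tendsto_error K)
      rw [dist_comm, Real.dist_eq]
      refine hL.abs_integral_sub_le h hσ m K.2 hfm hfK (hint σ ‹_›) ?_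
      exact Integrable.of_bound (hfm.comp ((h.measurable_orbit_left 0 (m + 1)).comp
        hL.measurable_seq_zero)).aestronglyMeasurable _ (Eventually.of_forall fun ω => hb _)
    exact tendsto_nhds_unique (hto ρ ‹_› hρ) (hto ρ' ‹_› hρ')
  let p : ProbabilityMeasure ℝ := ⟨ρ, ‹_›⟩
  let p' : ProbabilityMeasure ℝ := ⟨ρ', ‹_›⟩
  have ht : Tendsto (fun _ : ℕ => p) atTop (𝓝 p') :=
    tendsto_iff_forall_lipschitz_integral_tendsto.2 fun f hb hl => by
      change Tendsto (fun _ : ℕ => ∫ t, f t ∂ρ) atTop (𝓝 (∫ t, f t ∂ρ'))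
      rw [key f hb hl]
      exact tendsto_const_nhds
  have hpp : p = p' := tendsto_nhds_unique tendsto_const_nhds ht
  exact congrArg (fun q : ProbabilityMeasure ℝ => (q : Measure ℝ)) hpp

/-- By `backwardLim_eq` the limit is `L 0` plus φ of the limit for the shifted noise, which is
independent of `L 0` and has the same law. -/
theorem IsIIDSeq.isStationary_backwardLim (hL : IsIIDSeq P L) (h : BoundedContraction φ c B) :
    IsStationary (P.map (L 0)) φ (P.map fun ω => backwardLim φ fun k => L k ω) := by
  have hm : Measurable fun ω => backwardLim φ fun k => L k ω :=
    h.measurable_backwardLim.comp hL.measurable_seq_zero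
  have hm1 : Measurable fun ω => backwardLim φ fun k => L (1 + k) ω :=
    h.measurable_backwardLim.comp (hL.measurable_seq 1)
  have hshift : Measurable fun l : ℕ → ℝ => fun k => l (1 + k) := by fun_prop
  have hind : IndepFun (L 0) (fun ω => backwardLim φ fun k => L (1 + k) ω) P := by
    refine hL.indepFun_of_dependsOn (f := fun l => l 0)
      (g := fun l => backwardLim φ fun k => l (1 + k)) (S := {0}) (T := Set.Ici 1)
      (measurable_pi_apply 0) (h.measurable_backwardLim.comp hshift) (fun x y hxy => hxy 0 rfl)
      (fun x y hxy => ?_) (by simp)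
    have : (fun k => x (1 + k)) = fun k => y (1 + k) := funext fun k => hxy _ (by simp)
    simp only [this]
  have hp := (indepFun_iff_map_prod_eq_prod_map_map (hL.measurable 0).aemeasurable
    hm1.aemeasurable).1 hind
  rw [(hL.identDistrib_shift 1 h.measurable_backwardLim).map_eq] at hp
  unfold IsStationary
  rw [← hp]
  refine (Measure.map_map (measurable_fst.add (h.measurable.comp measurable_snd))
    ((hL.measurable 0).prodMk hm1)).trans ?_
  congr 1
  funext ω
  have := h.backwardLim_eq fun k => L k ω
  simp only [add_comm _ 1] at this
  exact this.symm

end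

/-! ### Ergodic theorem along an orbit -/

section

variable {Ω : Type*} [MeasurableSpace Ω] {P : Measure Ω}

/-- Scheffé's lemma for a constant limit. -/
theorem tendsto_integral_abs_sub_of_tendsto [IsProbabilityMeasure P] {f : ℕ → Ω → ℝ} {a : ℝ}
    (hf0 : ∀ n ω, 0 ≤ f n ω) (hfi : ∀ n, Integrable (f n) P)
    (hae : ∀ᵐ ω ∂P, Tendsto (fun n => f n ω) atTop (𝓝 a))
    (hint : Tendsto (fun n => ∫ ω, f n ω ∂P) atTop (𝓝 a)) :
    Tendsto (fun n => ∫ ω, |f n ω - a| ∂P) atTop (𝓝 0) := by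
  have hi : ∀ n, Integrable (fun ω => max (a - f n ω) 0) P := fun n =>
    ((integrable_const a).sub (hfi n)).pos_part
  have h1 : Tendsto (fun n => ∫ ω, max (a - f n ω) 0 ∂P) atTop (𝓝 (∫ _ω : Ω, (0 : ℝ) ∂P)) := by
    refine tendsto_integral_of_dominated_convergence (fun _ => |a|) (fun n => (hi n).1)
      (integrable_const _) (fun n => Eventually.of_forall fun ω => ?_) ?_
    · rw [Real.norm_eq_abs, abs_of_nonneg (le_max_right _ _)]
      exact max_le (by linarith [hf0 n ω, le_abs_self a]) (abs_nonneg a)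
    · filter_upwards [hae] with ω hω
      have := (tendsto_const_nhds (x := a)).sub hω
      rw [sub_self] at this
      simpa using this.max (tendsto_const_nhds (x := (0 : ℝ)))
  -- |f - a| = (f - a) + 2(a - f)⁺. The first mean tends to 0 by hypothesis, the second by
  -- domination, since (a - f)⁺ ≤ |a|.
  have e : ∀ n, ∫ ω, |f n ω - a| ∂P = (∫ ω, f n ω ∂P) - a + 2 * ∫ ω, max (a - f n ω) 0 ∂P := by
    intro n
    have : ∀ ω, |f n ω - a| = (f n ω - a) + 2 * max (a - f n ω) 0 := fun ω => by
      rcases le_total (f n ω) a with h | h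
      · rw [abs_of_nonpos (by linarith), max_eq_left (by linarith)]; ring
      · rw [abs_of_nonneg (by linarith), max_eq_right (by linarith)]; ring
    simp only [this]
    have hfa : Integrable (fun ω => f n ω - a) P := (hfi n).sub (integrable_const a)
    rw [integral_add hfa ((hi n).const_mul 2),
      integral_sub (hfi n) (integrable_const a), integral_const_mul]
    simp
  simp only [e]
  have := (hint.sub_const a).add (h1.const_mul 2)
  simpa using this

variable {L : ℕ → Ω → ℝ} {φ ψ : ℝ → ℝ} {c B : ℝ}

/-- A term is the difference of consecutive partial sums, whose averages have the same limit. This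
removes the contribution of the last factor to the growth rate. -/
theorem IsIIDSeq.tendsto_div_zero [IsProbabilityMeasure P] (hL : IsIIDSeq P L) {G : ℝ → ℝ}
    (hG : Measurable G) (hi : Integrable (fun ω => G (L 0 ω)) P) :
    ∀ᵐ ω ∂P, Tendsto (fun n : ℕ => G (L n ω) / ((n : ℝ) + 1)) atTop (𝓝 0) := by
  have h := strong_law_ae_real (fun n ω => G (L n ω)) hi
    (fun i j hij => (hL.indep.indepFun hij).comp hG hG) (fun i => (hL.ident i).comp hG)
  filter_upwards [h] with ω hω
  have h1 := (tendsto_add_atTop_iff_nat 1).2 hω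
  have h2 : Tendsto (fun n : ℕ => (n : ℝ) / (n + 1)) atTop (𝓝 1) :=
    tendsto_natCast_div_add_atTop 1
  have h3 := h1.sub (hω.mul h2)
  rw [mul_one, sub_self] at h3
  refine h3.congr' ?_
  filter_upwards [eventually_gt_atTop 0] with n hn
  have hn' : (n : ℝ) ≠ 0 := by exact_mod_cast hn.ne'
  rw [div_mul_div_cancel₀ hn', Finset.sum_range_succ]
  push_cast
  ring

/-- `ψ` is a nonnegative function of Lipschitz constant `1`. -/
structure IsObservable (ψ : ℝ → ℝ) : Prop where
  nonneg : ∀ t, 0 ≤ ψ t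
  lip : ∀ s t, |ψ s - ψ t| ≤ |s - t|

theorem IsObservable.measurable (h : IsObservable ψ) : Measurable ψ := by
  have : LipschitzWith 1 ψ := LipschitzWith.of_dist_le_mul fun x y => by
    simpa [Real.dist_eq] using h.lip x y
  exact this.continuous.measurable

/-- Since φ is bounded, integrability of ψ under the noise passes to orbits and to stationary laws.
-/
theorem IsObservable.le_add (h : IsObservable ψ) (hφ : BoundedContraction φ c B) (l t : ℝ) :
    ψ (l + φ t) ≤ ψ l + B := by
  have h1 := (abs_le.1 (h.lip (l + φ t) l)).2
  have h2 := hφ.bound t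
  rw [add_sub_cancel_left] at h1
  linarith

theorem IsObservable.integrable_orbit [IsProbabilityMeasure P] (h : IsObservable ψ)
    (hφ : BoundedContraction φ c B) (hL : IsIIDSeq P L)
    (hi : Integrable (fun ω => ψ (L 0 ω)) P) (n k : ℕ) :
    Integrable (fun ω => ψ (orbit φ (fun i => L (n + i) ω) 0 k)) P := by
  cases k with
  | zero => exact integrable_const (ψ 0)
  | succ k =>
    have hi' : Integrable (fun ω => ψ (L (n + k) ω)) P :=
      ((hL.ident (n + k)).comp h.measurable).integrable_iff.2 hi
    have hB : Integrable (fun ω => ψ (L (n + k) ω) + B) P := hi'.add (integrable_const B)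
    refine hB.mono' (h.measurable.comp
      ((hφ.measurable_orbit_left 0 (k + 1)).comp (hL.measurable_seq n))).aestronglyMeasurable
      (Eventually.of_forall fun ω => ?_)
    rw [Real.norm_eq_abs, abs_of_nonneg (h.nonneg _)]
    exact h.le_add hφ _ _

theorem IsObservable.integrable_stationary (h : IsObservable ψ)
    (hφ : BoundedContraction φ c B) {μ ρ : Measure ℝ} [IsProbabilityMeasure μ]
    [IsProbabilityMeasure ρ] (hρ : IsStationary μ φ ρ) (hi : Integrable ψ μ) :
    Integrable ψ ρ := by
  have hm : Measurable fun p : ℝ × ℝ => p.1 + φ p.2 :=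
    measurable_fst.add (hφ.measurable.comp measurable_snd)
  rw [← hρ]
  refine (integrable_map_measure h.measurable.aestronglyMeasurable hm.aemeasurable).2 ?_
  have hB : Integrable (fun p : ℝ × ℝ => ψ p.1 + B) (μ.prod ρ) :=
    (hi.comp_fst ρ).add (integrable_const B)
  refine hB.mono'
    (h.measurable.comp hm).aestronglyMeasurable (Eventually.of_forall fun p => ?_)
  simp only [Function.comp]
  rw [Real.norm_eq_abs, abs_of_nonneg (h.nonneg _)]
  exact h.le_add hφ _ _

variable [IsProbabilityMeasure P]

/-- Windows whose starting times are at least m apart use disjoint blocks of noise, so the strong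
law of finite range applies. -/
theorem IsObservable.ae_tendsto_window (h : IsObservable ψ)
    (hφ : BoundedContraction φ c B) (hL : IsIIDSeq P L)
    (hi : Integrable (fun ω => ψ (L 0 ω)) P) {m : ℕ} (hm : 0 < m) :
    ∀ᵐ ω ∂P, Tendsto (fun n : ℕ =>
      (∑ k ∈ Finset.range n, ψ (orbit φ (fun i => L (k + i) ω) 0 m)) / n) atTop
      (𝓝 (∫ ω, ψ (orbit φ (fun i => L i ω) 0 m) ∂P)) := by
  have hf : Measurable fun l : ℕ → ℝ => ψ (orbit φ l 0 m) :=
    h.measurable.comp (hφ.measurable_orbit_left 0 m)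
  have hs : ∀ k, Measurable fun l : ℕ → ℝ => fun i => l (k + i) := fun k => by fun_prop
  have hd : ∀ k, DependsOn (fun l : ℕ → ℝ => ψ (orbit φ (fun i => l (k + i)) 0 m))
      (Set.Ico k (k + m)) := fun k x y hxy =>
    congrArg ψ (dependsOn_orbit_shift φ 0 k m hxy)
  have := strong_law_of_finite_range (P := P)
    (Y := fun k ω => ψ (orbit φ (fun i => L (k + i) ω) 0 m))
    (fun _ _ => h.nonneg _) (h.integrable_orbit hφ hL hi 0 m)
    (fun k => (hL.identDistrib_shift k hf).trans (hL.identDistrib_shift 0 hf).symm) hm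
    (fun k k' hk => hL.indepFun_of_dependsOn (hf.comp (hs k)) (hf.comp (hs k')) (hd k) (hd k')
      (Set.disjoint_left.2 fun i hi hi' => by
        have := hi.2
        have := hi'.1
        omega))
  simpa only [zero_add] using this

/-- The ergodic theorem along an orbit, almost sure version. -/
theorem IsObservable.ae_tendsto_average (h : IsObservable ψ)
    (hφ : BoundedContraction φ c B) (hL : IsIIDSeq P L)
    (hi : Integrable (fun ω => ψ (L 0 ω)) P) {ρ : Measure ℝ} [IsProbabilityMeasure ρ]
    (hρ : IsStationary (P.map (L 0)) φ ρ) :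
    ∀ᵐ ω ∂P, Tendsto (fun n : ℕ =>
      (∑ k ∈ Finset.range n, ψ (orbit φ (fun i => L i ω) 0 k)) / n) atTop
      (𝓝 (∫ t, ψ t ∂ρ)) := by
  have : IsProbabilityMeasure (P.map (L 0)) :=
    Measure.isProbabilityMeasure_map (hL.measurable 0).aemeasurable
  have hψρ : Integrable ψ ρ := h.integrable_stationary hφ hρ
    ((integrable_map_measure h.measurable.aestronglyMeasurable
      (hL.measurable 0).aemeasurable).2 hi)
  filter_upwards [ae_all_iff.2 fun m => h.ae_tendsto_window hφ hL hi (Nat.succ_pos m)] with ω hω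
  rw [Metric.tendsto_atTop]
  intro η hη
  -- The error δ enters twice, so η/4 leaves η/2 for the strong law and the initial segment.
  obtain ⟨m, hm⟩ := ((hφ.tendsto_error 1).eventually (gt_mem_nhds (show (0 : ℝ) < η / 4 by
    linarith))).exists
  set δ := 1 * (2 * B * c ^ m) with hδ
  set Λ := ∫ t, ψ t ∂ρ with hΛ
  set E := ∫ ω, ψ (orbit φ (fun i => L i ω) 0 (m + 1)) ∂P with hE
  have hΛE : |Λ - E| ≤ δ :=
    hL.abs_integral_sub_le hφ hρ m zero_le_one h.measurable
      (fun s t => by simpa using h.lip s t) hψρ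
      (by simpa only [zero_add] using h.integrable_orbit hφ hL hi 0 (m + 1))
  set u : ℕ → ℝ := fun k => ψ (orbit φ (fun i => L i ω) 0 k) with hu
  set v : ℕ → ℝ := fun k => ψ (orbit φ (fun i => L (k + i) ω) 0 (m + 1)) with hv
  -- At time `m + 1 + k` the true orbit and the one restarted at 0 at time k have shared their last
  -- `m + 1` noises.
  have huv : ∀ k, |u (m + 1 + k) - v k| ≤ δ := fun k => by
    rw [hu, hv, hδ, one_mul]
    simp only
    rw [add_comm (m + 1) k, orbit_add]
    exact (h.lip _ _).trans (hφ.orbit_dist _ _ _ _)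
  set C := |∑ k ∈ Finset.range (m + 1), u k - (m + 1 : ℕ) * Λ| with hC
  have hlim : Tendsto (fun n : ℕ => |(∑ k ∈ Finset.range n, v k) / n - E| + C / n) atTop
      (𝓝 0) := by
    have h1 := ((hω m).sub_const E).abs
    rw [sub_self, abs_zero] at h1
    simpa using h1.add (tendsto_const_div_atTop_nhds_zero_nat C)
  obtain ⟨N, hN⟩ := eventually_atTop.1
    ((hlim.eventually (gt_mem_nhds (show (0 : ℝ) < η / 2 by linarith))).and
      (eventually_gt_atTop 0))
  refine ⟨m + 1 + N, fun n' hn' => ?_⟩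
  obtain ⟨n, rfl⟩ : ∃ n, n' = m + 1 + n := ⟨n' - (m + 1), by omega⟩
  obtain ⟨hn1, hn0⟩ := hN n (by omega)
  have hn : (0 : ℝ) < n := by exact_mod_cast hn0
  have hcast : ((m + 1 + n : ℕ) : ℝ) = (m + 1 : ℕ) + (n : ℝ) := by push_cast; ring
  have hpos : (0 : ℝ) < ((m + 1 + n : ℕ) : ℝ) := by positivity
  have hle : (n : ℝ) ≤ ((m + 1 + n : ℕ) : ℝ) := by exact_mod_cast Nat.le_add_left _ _
  have hsum : |∑ k ∈ Finset.range n, (u (m + 1 + k) - v k)| ≤ n * δ := by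
    refine (Finset.abs_sum_le_sum_abs _ _).trans ((Finset.sum_le_sum fun k _ => huv k).trans ?_)
    simp
  have hv' : |∑ k ∈ Finset.range n, v k - n * E| = n * |(∑ k ∈ Finset.range n, v k) / n - E| := by
    rw [← abs_of_pos hn, ← abs_mul, abs_of_pos hn]
    congr 1
    field_simp
  have hC' : C = n * (C / n) := by field_simp
  have hEn : |n * E - n * Λ| ≤ n * δ := by
    rw [← mul_sub, abs_mul, abs_of_pos hn, abs_sub_comm]
    exact mul_le_mul_of_nonneg_left hΛE hn.le
  -- Four errors: the fixed initial segment, forgetting of the past, the strong law for windows, and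
  -- the bias of a window mean against the stationary mean.
  have hdec : ∑ k ∈ Finset.range (m + 1 + n), u k - ((m + 1 + n : ℕ) : ℝ) * Λ
      = (∑ k ∈ Finset.range (m + 1), u k - (m + 1 : ℕ) * Λ)
        + ∑ k ∈ Finset.range n, (u (m + 1 + k) - v k)
        + (∑ k ∈ Finset.range n, v k - n * E) + (n * E - n * Λ) := by
    rw [Finset.sum_range_add, hcast, Finset.sum_sub_distrib]; ring
  have hbound : |∑ k ∈ Finset.range (m + 1 + n), u k - ((m + 1 + n : ℕ) : ℝ) * Λ| < n * η := by
    rw [hdec]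
    calc _ ≤ C + n * δ + n * |(∑ k ∈ Finset.range n, v k) / n - E| + n * δ := by
          rw [← hv']
          exact (abs_add_le _ _).trans (add_le_add ((abs_add_le _ _).trans
            (add_le_add ((abs_add_le _ _).trans (add_le_add le_rfl hsum)) le_rfl)) hEn)
      _ = n * (|(∑ k ∈ Finset.range n, v k) / n - E| + C / n + 2 * δ) := by
          conv_lhs => rw [hC']
          ring
      _ < n * η := by
          apply mul_lt_mul_of_pos_left _ hn
          linarith
  rw [Real.dist_eq]
  have : (∑ k ∈ Finset.range (m + 1 + n), u k) / ((m + 1 + n : ℕ) : ℝ) - Λ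
      = (∑ k ∈ Finset.range (m + 1 + n), u k - ((m + 1 + n : ℕ) : ℝ) * Λ)
        / ((m + 1 + n : ℕ) : ℝ) := by
    field_simp
  rw [this, abs_div, abs_of_pos hpos, div_lt_iff₀ hpos]
  calc _ < n * η := hbound
    _ ≤ _ := by rw [mul_comm]; exact mul_le_mul_of_nonneg_left hle hη.le

/-- The ergodic theorem along an orbit, convergence in mean. -/
theorem IsObservable.tendsto_integral_average (h : IsObservable ψ)
    (hφ : BoundedContraction φ c B) (hL : IsIIDSeq P L)
    (hi : Integrable (fun ω => ψ (L 0 ω)) P) {ρ : Measure ℝ} [IsProbabilityMeasure ρ]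
    (hρ : IsStationary (P.map (L 0)) φ ρ) :
    Tendsto (fun n : ℕ => ∫ ω,
      |(∑ k ∈ Finset.range n, ψ (orbit φ (fun i => L i ω) 0 k)) / n - ∫ t, ψ t ∂ρ| ∂P) atTop
      (𝓝 0) := by
  have : IsProbabilityMeasure (P.map (L 0)) :=
    Measure.isProbabilityMeasure_map (hL.measurable 0).aemeasurable
  have hψρ : Integrable ψ ρ := h.integrable_stationary hφ hρ
    ((integrable_map_measure h.measurable.aestronglyMeasurable
      (hL.measurable 0).aemeasurable).2 hi)
  have ho : ∀ k, Integrable (fun ω => ψ (orbit φ (fun i => L i ω) 0 k)) P := fun k => by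
    simpa only [zero_add] using h.integrable_orbit hφ hL hi 0 k
  refine tendsto_integral_abs_sub_of_tendsto
    (fun n ω => div_nonneg (Finset.sum_nonneg fun k _ => h.nonneg _) (Nat.cast_nonneg n))
    (fun n => (integrable_finsetSum _ fun k _ => ho k).div_const _)
    (h.ae_tendsto_average hφ hL hi hρ) ?_
  -- By Scheffé only the means matter. They converge at each time by geometric mixing, hence so do
  -- their Cesàro averages.
  have h1 : Tendsto (fun k => ∫ ω, ψ (orbit φ (fun i => L i ω) 0 k) ∂P) atTop
      (𝓝 (∫ t, ψ t ∂ρ)) := by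
    rw [← tendsto_add_atTop_iff_nat 1, tendsto_iff_dist_tendsto_zero]
    refine squeeze_zero (fun _ => dist_nonneg) (fun m => ?_) (hφ.tendsto_error 1)
    rw [dist_comm, Real.dist_eq]
    exact hL.abs_integral_sub_le hφ hρ m zero_le_one h.measurable
      (fun s t => by simpa using h.lip s t) hψρ (ho (m + 1))
  refine h1.cesaro.congr fun n => ?_
  rw [integral_div, integral_finsetSum _ fun k _ => ho k, div_eq_inv_mul]

end

/-! ### The recursion in logarithmic coordinates -/

/-- The map `x ↦ (1 + x) / (1 + ε² x)` in logarithmic coordinates. -/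
def logMap (ε t : ℝ) : ℝ := Real.log (1 + Real.exp t) - Real.log (1 + ε ^ 2 * Real.exp t)

/-- The logarithmic increment `log (1 + ε² x)` in the coordinate `t = log x`. -/
def logIncr (ε t : ℝ) : ℝ := Real.log (1 + ε ^ 2 * Real.exp t)

theorem one_add_mul_exp_pos (ε t : ℝ) : 0 < 1 + ε ^ 2 * Real.exp t := by positivity

theorem exp_logMap (ε t : ℝ) :
    Real.exp (logMap ε t) = (1 + Real.exp t) / (1 + ε ^ 2 * Real.exp t) := by
  rw [logMap, Real.exp_sub, Real.exp_log (by positivity), Real.exp_log (by positivity)]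

theorem exp_logIncr (ε t : ℝ) : Real.exp (logIncr ε t) = 1 + ε ^ 2 * Real.exp t := by
  rw [logIncr, Real.exp_log (by positivity)]

theorem hasDerivAt_log_one_add_mul_exp {a : ℝ} (ha : 0 ≤ a) (t : ℝ) :
    HasDerivAt (fun t => Real.log (1 + a * Real.exp t))
      (a * Real.exp t / (1 + a * Real.exp t)) t := by
  have : HasDerivAt (fun t => 1 + a * Real.exp t) (a * Real.exp t) t :=
    ((Real.hasDerivAt_exp t).const_mul a).const_add 1
  exact this.log (by positivity)

/-- With w = eᵗ the derivative is (1 - ε²)w/((1 + w)(1 + ε²w)), extremal at w = 1/ε, which gives the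
ratio. The bound holds because (1 + w)/(1 + ε²w) lies between 1 and ε⁻². -/
theorem boundedContraction_logMap {ε : ℝ} (hε : 0 < ε) :
    BoundedContraction (logMap ε) (|1 - ε ^ 2| / (1 + ε) ^ 2) |Real.log (ε ^ 2)| where
  nonneg := by positivity
  lt_one := by
    rw [div_lt_one (by positivity), abs_lt]
    constructor <;> nlinarith
  lip := by
    intro s t
    have hd : ∀ x ∈ (Set.univ : Set ℝ), HasDerivWithinAt (logMap ε)
        (1 * Real.exp x / (1 + 1 * Real.exp x) - ε ^ 2 * Real.exp x / (1 + ε ^ 2 * Real.exp x))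
        Set.univ x := fun x _ => by
      have h1 := hasDerivAt_log_one_add_mul_exp zero_le_one x
      simp only [one_mul] at h1 ⊢
      exact (h1.sub (hasDerivAt_log_one_add_mul_exp (sq_nonneg ε) x)).hasDerivWithinAt
    have hb : ∀ x ∈ (Set.univ : Set ℝ), ‖1 * Real.exp x / (1 + 1 * Real.exp x)
        - ε ^ 2 * Real.exp x / (1 + ε ^ 2 * Real.exp x)‖ ≤ |1 - ε ^ 2| / (1 + ε) ^ 2 := by
      intro x _
      set w := Real.exp x with hw
      have hwp : 0 < w := Real.exp_pos x
      have e : 1 * w / (1 + 1 * w) - ε ^ 2 * w / (1 + ε ^ 2 * w)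
          = (1 - ε ^ 2) * (w / ((1 + w) * (1 + ε ^ 2 * w))) := by
        field_simp
        ring
      rw [e, Real.norm_eq_abs, abs_mul, abs_of_pos (a := w / _) (by positivity),
        div_eq_mul_one_div |1 - ε ^ 2|]
      refine mul_le_mul_of_nonneg_left ?_ (abs_nonneg _)
      rw [div_le_div_iff₀ (by positivity) (by positivity)]
      -- (1 + w)(1 + ε²w) - (1 + ε)²w = (1 - εw)².
      nlinarith [sq_nonneg (1 - ε * w)]
    simpa only [Real.norm_eq_abs] using
      convex_univ.norm_image_sub_le_of_norm_hasDerivWithin_le hd hb (Set.mem_univ t)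
        (Set.mem_univ s)
  bound := by
    intro t
    have h2 : 0 < ε ^ 2 := by positivity
    set B := |Real.log (ε ^ 2)|
    have hw : 0 < Real.exp t := Real.exp_pos t
    have h1 : 1 ≤ Real.exp B := Real.one_le_exp (abs_nonneg _)
    have hB1 : ε ^ 2 ≤ Real.exp B := by
      rw [← Real.log_le_iff_le_exp h2]; exact le_abs_self _
    have hB2 : 1 ≤ Real.exp B * ε ^ 2 := by
      have : Real.exp (-B) ≤ ε ^ 2 := by
        rw [← Real.le_log_iff_exp_le h2]; exact neg_abs_le _
      calc (1 : ℝ) = Real.exp B * Real.exp (-B) := by rw [← Real.exp_add]; simp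
        _ ≤ _ := mul_le_mul_of_nonneg_left this (Real.exp_pos _).le
    have u1 : Real.log (1 + Real.exp t) ≤ B + Real.log (1 + ε ^ 2 * Real.exp t) := by
      rw [Real.log_le_iff_le_exp (by positivity), Real.exp_add, Real.exp_log (by positivity)]
      nlinarith
    have u2 : Real.log (1 + ε ^ 2 * Real.exp t) ≤ B + Real.log (1 + Real.exp t) := by
      rw [Real.log_le_iff_le_exp (by positivity), Real.exp_add, Real.exp_log (by positivity)]
      nlinarith
    rw [logMap, abs_le]
    constructor <;> linarith

theorem isObservable_logIncr (ε : ℝ) : IsObservable (logIncr ε) where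
  nonneg t := Real.log_nonneg (by have := Real.exp_pos t; nlinarith [sq_nonneg ε])
  lip := by
    have key : ∀ s t, logIncr ε s ≤ |s - t| + logIncr ε t := by
      intro s t
      rw [logIncr, Real.log_le_iff_le_exp (by positivity), Real.exp_add, exp_logIncr]
      have h1 : 1 ≤ Real.exp |s - t| := Real.one_le_exp (abs_nonneg _)
      have h2 : Real.exp s ≤ Real.exp |s - t| * Real.exp t := by
        rw [← Real.exp_add, Real.exp_le_exp]
        linarith [le_abs_self (s - t)]
      nlinarith [mul_le_mul_of_nonneg_left h2 (sq_nonneg ε)]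
    intro s t
    have h1 := key s t
    have h2 := key t s
    rw [abs_sub_comm t s] at h2
    rw [abs_le]
    constructor <;> linarith

theorem logMap_nonneg {ε : ℝ} (hε : 0 < ε) (h1 : ε ≤ 1) (t : ℝ) : 0 ≤ logMap ε t := by
  refine sub_nonneg.2 (Real.log_le_log (by positivity) ?_)
  have : ε ^ 2 ≤ 1 := pow_le_one₀ hε.le h1
  nlinarith [Real.exp_pos t]

theorem exp_logMap_le (ε t : ℝ) : Real.exp (logMap ε t) ≤ 1 + Real.exp t := by
  rw [exp_logMap]
  refine div_le_self (by positivity) ?_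
  nlinarith [mul_nonneg (sq_nonneg ε) (Real.exp_pos t).le]

/-! ### Invariant laws in logarithmic coordinates -/

theorem measurable_invariantMap (ε : ℝ) :
    Measurable fun p : ℝ × ℝ => p.1 * ((1 + p.2) / (1 + ε ^ 2 * p.2)) := by fun_prop

/-- The exponential conjugates the additive recursion to the multiplicative one, so stationary laws
and invariant laws correspond. -/
theorem map_exp_map_logMap {ε : ℝ} (hε : 0 < ε) (μ ρ : Measure ℝ) [IsProbabilityMeasure μ]
    [IsProbabilityMeasure ρ] :
    ((μ.prod ρ).map fun p : ℝ × ℝ => p.1 + logMap ε p.2).map Real.exp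
      = ((μ.map Real.exp).prod (ρ.map Real.exp)).map
          fun p : ℝ × ℝ => p.1 * ((1 + p.2) / (1 + ε ^ 2 * p.2)) := by
  have hm : Measurable fun p : ℝ × ℝ => p.1 + logMap ε p.2 :=
    measurable_fst.add ((boundedContraction_logMap hε).measurable.comp measurable_snd)
  rw [Measure.map_prod_map _ _ Real.measurable_exp Real.measurable_exp,
    Measure.map_map Real.measurable_exp hm,
    Measure.map_map (measurable_invariantMap ε)
      (Real.measurable_exp.prodMap Real.measurable_exp)]
  congr 1
  funext p
  simp only [Function.comp, Prod.map]
  rw [Real.exp_add, exp_logMap]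

theorem map_exp_map_log {μ : Measure ℝ} (h : ∀ᵐ x ∂μ, 0 < x) :
    (μ.map Real.log).map Real.exp = μ := by
  rw [Measure.map_map Real.measurable_exp Real.measurable_log]
  conv_rhs => rw [← Measure.map_id (μ := μ)]
  refine Measure.map_congr ?_
  filter_upwards [h] with x hx
  exact Real.exp_log hx

theorem map_log_map_exp (μ : Measure ℝ) : (μ.map Real.exp).map Real.log = μ := by
  rw [Measure.map_map Real.measurable_log Real.measurable_exp]
  have : Real.log ∘ Real.exp = id := funext Real.log_exp
  rw [this, Measure.map_id]

theorem isInvariantLaw_map_exp {ε : ℝ} (hε : 0 < ε) {μ ρ : Measure ℝ} [IsProbabilityMeasure μ]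
    [IsProbabilityMeasure ρ] (hμ : ∀ᵐ x ∂μ, 0 < x)
    (hρ : IsStationary (μ.map Real.log) (logMap ε) ρ) :
    IsInvariantLaw μ ε (ρ.map Real.exp) where
  prob := Measure.isProbabilityMeasure_map Real.measurable_exp.aemeasurable
  nonneg := by
    rw [ae_map_iff Real.measurable_exp.aemeasurable measurableSet_Ici]
    exact Eventually.of_forall fun t => (Real.exp_pos t).le
  invariant := by
    have := Measure.isProbabilityMeasure_map Real.measurable_log.aemeasurable (μ := μ)
    have h := map_exp_map_logMap hε (μ.map Real.log) ρ
    rw [map_exp_map_log hμ] at h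
    rw [← h, hρ]

/-- One step of the recursion produces a positive value even from 0, so an invariant law has no atom
at 0 and can be transported by the logarithm. -/
theorem IsInvariantLaw.ae_pos {ε : ℝ} {μ ν : Measure ℝ} [IsProbabilityMeasure μ]
    (hμ : ∀ᵐ x ∂μ, 0 < x) (hν : IsInvariantLaw μ ε ν) : ∀ᵐ x ∂ν, 0 < x := by
  have := hν.prob
  rw [← hν.invariant,
    ae_map_iff (measurable_invariantMap ε).aemeasurable measurableSet_Ioi]
  have h1 : ∀ᵐ p ∂(μ.prod ν), 0 < p.1 := Measure.quasiMeasurePreserving_fst.ae hμ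
  have h2 : ∀ᵐ p ∂(μ.prod ν), 0 ≤ p.2 := Measure.quasiMeasurePreserving_snd.ae hν.nonneg
  filter_upwards [h1, h2] with p hp1 hp2
  positivity

theorem IsInvariantLaw.isStationary {ε : ℝ} (hε : 0 < ε) {μ ν : Measure ℝ}
    [IsProbabilityMeasure μ] (hμ : ∀ᵐ x ∂μ, 0 < x) (hν : IsInvariantLaw μ ε ν) :
    IsStationary (μ.map Real.log) (logMap ε) (ν.map Real.log) := by
  have := hν.prob
  have := Measure.isProbabilityMeasure_map Real.measurable_log.aemeasurable (μ := μ)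
  have := Measure.isProbabilityMeasure_map Real.measurable_log.aemeasurable (μ := ν)
  have h := map_exp_map_logMap hε (μ.map Real.log) (ν.map Real.log)
  rw [map_exp_map_log hμ, map_exp_map_log (hν.ae_pos hμ), hν.invariant] at h
  have h' := congrArg (Measure.map Real.log) h
  rwa [map_log_map_exp] at h'

/-! ### Products of matrices -/

theorem matProd_succ (ε : ℝ) (z : ℕ → ℝ) (n : ℕ) (y : Fin 2 → ℝ) :
    (matProd ε z (n + 1)).mulVec y
      = ![((matProd ε z n).mulVec y) 0 + ε * ((matProd ε z n).mulVec y) 1,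
          ε * z n * ((matProd ε z n).mulVec y) 0 + z n * ((matProd ε z n).mulVec y) 1] := by
  rw [matProd, ← Matrix.mulVec_mulVec]
  ext i
  fin_cases i <;> simp [mat, Matrix.mulVec, dotProduct, Fin.sum_univ_two]

/-- A vector (1, εeᵗ) is multiplied by 1 + ε²eᵗ while its t moves one step along the orbit. The
vector (1, ε) is t = 0. -/
theorem matProd_mulVec_base {ε : ℝ} {z : ℕ → ℝ} (hz : ∀ k, 0 < z k) (n : ℕ) :
    (matProd ε z n).mulVec ![1, ε]
      = ![Real.exp (∑ k ∈ Finset.range n,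
            logIncr ε (orbit (logMap ε) (fun k => Real.log (z k)) 0 k)),
          ε * Real.exp (∑ k ∈ Finset.range n,
            logIncr ε (orbit (logMap ε) (fun k => Real.log (z k)) 0 k))
            * Real.exp (orbit (logMap ε) (fun k => Real.log (z k)) 0 n)] := by
  induction n with
  | zero =>
    ext i
    fin_cases i <;> simp [matProd, orbit]
  | succ n ih =>
    rw [matProd_succ, ih, Finset.sum_range_succ, Real.exp_add, exp_logIncr]
    set a := Real.exp (∑ k ∈ Finset.range n,
      logIncr ε (orbit (logMap ε) (fun k => Real.log (z k)) 0 k))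
    rw [orbit]
    set t := orbit (logMap ε) (fun k => Real.log (z k)) 0 n
    rw [Real.exp_add, Real.exp_log (hz n), exp_logMap]
    have := (one_add_mul_exp_pos ε t).ne'
    ext i
    fin_cases i
    · simp; ring
    · simp; field_simp

/-- Up to constants, the products act in the same way on all nonzero nonnegative vectors. -/
theorem exists_matProd_sandwich {ε : ℝ} (hε : 0 < ε) {y : Fin 2 → ℝ} (hy : 0 ≤ y) (hy0 : y ≠ 0) :
    ∃ a b : ℝ, 0 < a ∧ 0 < b ∧ ∀ z : ℕ → ℝ, (∀ k, 0 < z k) → ∀ n i,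
      a * ((matProd ε z (n + 1)).mulVec ![1, ε]) i ≤ ((matProd ε z (n + 1)).mulVec y) i ∧
      ((matProd ε z (n + 1)).mulVec y) i ≤ b * ((matProd ε z (n + 1)).mulVec ![1, ε]) i := by
  have y0 : 0 ≤ y 0 := hy 0
  have y1 : 0 ≤ y 1 := hy 1
  have hor : 0 < y 0 ∨ 0 < y 1 := by
    by_contra! hcon
    refine hy0 (funext fun i => ?_)
    fin_cases i
    · exact le_antisymm hcon.1 y0
    · exact le_antisymm hcon.2 y1
  have hp : 0 < y 0 + ε * y 1 := by
    rcases hor with h | h <;> positivity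
  have hq : 0 < ε * y 0 + y 1 := by
    rcases hor with h | h <;> positivity
  -- These are the ratios of the coordinates of M₁y and M₁(1, ε), from which `z 0` cancels. Later
  -- factors have nonnegative entries and preserve the inequalities.
  refine ⟨min ((y 0 + ε * y 1) / (1 + ε ^ 2)) ((ε * y 0 + y 1) / (2 * ε)),
    max ((y 0 + ε * y 1) / (1 + ε ^ 2)) ((ε * y 0 + y 1) / (2 * ε)),
    lt_min (by positivity) (by positivity), lt_max_of_lt_left (by positivity), ?_⟩
  set a := min ((y 0 + ε * y 1) / (1 + ε ^ 2)) ((ε * y 0 + y 1) / (2 * ε)) with ha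
  set b := max ((y 0 + ε * y 1) / (1 + ε ^ 2)) ((ε * y 0 + y 1) / (2 * ε)) with hb
  have a1 : a * (1 + ε ^ 2) ≤ y 0 + ε * y 1 :=
    (le_div_iff₀ (by positivity)).1 (min_le_left _ _)
  have a2 : a * (2 * ε) ≤ ε * y 0 + y 1 :=
    (le_div_iff₀ (by positivity)).1 (min_le_right _ _)
  have b1 : y 0 + ε * y 1 ≤ b * (1 + ε ^ 2) :=
    (div_le_iff₀ (by positivity)).1 (le_max_left _ _)
  have b2 : ε * y 0 + y 1 ≤ b * (2 * ε) :=
    (div_le_iff₀ (by positivity)).1 (le_max_right _ _)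
  intro z hz n
  induction n with
  | zero =>
    intro i
    have h0 := hz 0
    have a2' := mul_le_mul_of_nonneg_left a2 h0.le
    have b2' := mul_le_mul_of_nonneg_left b2 h0.le
    rw [matProd_succ, matProd_succ]
    fin_cases i
    · simp [matProd]; constructor <;> nlinarith
    · simp [matProd]; constructor <;> nlinarith
  | succ n ih =>
    have h0 := ih 0
    have h1 := ih 1
    have hzn := hz (n + 1)
    have hεz := mul_pos hε hzn
    intro i
    rw [matProd_succ _ _ (n + 1), matProd_succ _ _ (n + 1)]
    set u := (matProd ε z (n + 1)).mulVec y
    set v := (matProd ε z (n + 1)).mulVec ![1, ε]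
    have e1 := mul_le_mul_of_nonneg_left h1.1 hε.le
    have e2 := mul_le_mul_of_nonneg_left h1.2 hε.le
    have e3 := mul_le_mul_of_nonneg_left h0.1 hεz.le
    have e4 := mul_le_mul_of_nonneg_left h0.2 hεz.le
    have e5 := mul_le_mul_of_nonneg_left h1.1 hzn.le
    have e6 := mul_le_mul_of_nonneg_left h1.2 hzn.le
    fin_cases i
    · simp only [Fin.zero_eta, Matrix.cons_val_zero]
      constructor <;> linarith [h0.1, h0.2]
    · simp only [Fin.mk_one, Matrix.cons_val_one, Matrix.cons_val_fin_one]
      constructor <;> linarith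

theorem abs_log_sub_log_le {a b u v : ℝ} (ha : 0 < a) (hb : 0 < b) (hu : 0 < u)
    (h1 : a * u ≤ v) (h2 : v ≤ b * u) :
    |Real.log v - Real.log u| ≤ |Real.log a| + |Real.log b| := by
  have hv : 0 < v := (mul_pos ha hu).trans_le h1
  have l1 := Real.log_le_log (mul_pos ha hu) h1
  have l2 := Real.log_le_log hv h2
  rw [Real.log_mul ha.ne' hu.ne'] at l1
  rw [Real.log_mul hb.ne' hu.ne'] at l2
  rw [abs_le]
  constructor
  · linarith [neg_abs_le (Real.log a), abs_nonneg (Real.log b)]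
  · linarith [le_abs_self (Real.log b), abs_nonneg (Real.log a)]

/-- The logarithm of an entry of the product differs little from the sum of the increments. -/
theorem exists_abs_log_sub_sum_le {ε : ℝ} (hε : 0 < ε) {x y : Fin 2 → ℝ} (hx : 0 ≤ x)
    (hx0 : x ≠ 0) (hy : 0 ≤ y) (hy0 : y ≠ 0) {G : ℝ → ℝ} {C : ℝ}
    (hG : ∀ l t, |Real.log (x 0 + ε * x 1 * Real.exp (l + logMap ε t))| ≤ C + G l) :
    ∃ C' : ℝ, ∀ z : ℕ → ℝ, (∀ k, 0 < z k) → ∀ n,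
      |Real.log (x ⬝ᵥ (matProd ε z (n + 1)).mulVec y) - ∑ k ∈ Finset.range (n + 1),
        logIncr ε (orbit (logMap ε) (fun k => Real.log (z k)) 0 k)| ≤ C' + G (Real.log (z n)) := by
  obtain ⟨a, b, ha, hb, hab⟩ := exists_matProd_sandwich hε hy hy0
  refine ⟨|Real.log a| + |Real.log b| + C, fun z hz n => ?_⟩
  have x0 : 0 ≤ x 0 := hx 0
  have x1 : 0 ≤ x 1 := hx 1
  have hor : 0 < x 0 ∨ 0 < x 1 := by
    by_contra! hcon
    refine hx0 (funext fun i => ?_)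
    fin_cases i
    · exact le_antisymm hcon.1 x0
    · exact le_antisymm hcon.2 x1
  set S := ∑ k ∈ Finset.range (n + 1),
    logIncr ε (orbit (logMap ε) (fun k => Real.log (z k)) 0 k) with hS
  set t := orbit (logMap ε) (fun k => Real.log (z k)) 0 (n + 1) with ht
  have hpos : 0 < x 0 + ε * x 1 * Real.exp t := by
    rcases hor with h | h <;> positivity
  have hv : x ⬝ᵥ (matProd ε z (n + 1)).mulVec ![1, ε]
      = Real.exp S * (x 0 + ε * x 1 * Real.exp t) := by
    rw [matProd_mulVec_base hz, dotProduct, Fin.sum_univ_two]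
    simp only [Matrix.cons_val_zero, Matrix.cons_val_one]
    ring
  have hvp : 0 < x ⬝ᵥ (matProd ε z (n + 1)).mulVec ![1, ε] := by
    rw [hv]; positivity
  have h0 := hab z hz n 0
  have h1 := hab z hz n 1
  have k1 := mul_le_mul_of_nonneg_left h0.1 x0
  have k2 := mul_le_mul_of_nonneg_left h0.2 x0
  have k3 := mul_le_mul_of_nonneg_left h1.1 x1
  have k4 := mul_le_mul_of_nonneg_left h1.2 x1
  have hlog := abs_log_sub_log_le ha hb hvp (v := x ⬝ᵥ (matProd ε z (n + 1)).mulVec y)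
    (by rw [dotProduct, dotProduct, Fin.sum_univ_two, Fin.sum_univ_two]; linarith)
    (by rw [dotProduct, dotProduct, Fin.sum_univ_two, Fin.sum_univ_two]; linarith)
  rw [hv, Real.log_mul (Real.exp_pos _).ne' hpos.ne', Real.log_exp] at hlog
  have hq := hG (Real.log (z n)) (orbit (logMap ε) (fun k => Real.log (z k)) 0 n)
  change |Real.log (x 0 + ε * x 1 * Real.exp t)| ≤ _ at hq
  rw [abs_le] at hlog hq ⊢
  constructor <;> linarith [hlog.1, hlog.2, hq.1, hq.2]

/-- A positive `x 0` bounds the logarithm from below, so only large values of l need control, and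
`logIncr` suffices. -/
theorem exists_abs_log_le_of_pos {ε : ℝ} (hε : 0 < ε) {x : Fin 2 → ℝ} (hx : 0 ≤ x)
    (hx0 : 0 < x 0) :
    ∃ C : ℝ, ∀ l t, |Real.log (x 0 + ε * x 1 * Real.exp (l + logMap ε t))|
      ≤ C + logIncr ε l := by
  have x1 : 0 ≤ x 1 := hx 1
  set B := |Real.log (ε ^ 2)|
  -- Chosen so that x₀ + εx₁w ≤ K(1 + ε²w) for all w ≥ 0.
  set K := x 0 + x 1 / ε with hK
  have hKp : 0 < K := by positivity
  refine ⟨|Real.log (x 0)| + |Real.log K| + B, fun l t => ?_⟩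
  set s := l + logMap ε t with hs
  have hψ := (isObservable_logIncr ε).le_add (boundedContraction_logMap hε) l t
  have hψ0 := (isObservable_logIncr ε).nonneg l
  have hB : 0 ≤ B := abs_nonneg _
  have hes := Real.exp_pos s
  have hnn : 0 ≤ ε * x 1 * Real.exp s := by positivity
  have h1 : Real.log (x 0) ≤ Real.log (x 0 + ε * x 1 * Real.exp s) :=
    Real.log_le_log hx0 (by linarith)
  have h2 : Real.log (x 0 + ε * x 1 * Real.exp s) ≤ Real.log K + logIncr ε s := by
    rw [Real.log_le_iff_le_exp (by positivity), Real.exp_add (Real.log K), Real.exp_log hKp,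
      exp_logIncr, hK]
    have : (x 0 + x 1 / ε) * (1 + ε ^ 2 * Real.exp s)
        = x 0 + ε * x 1 * Real.exp s + x 1 / ε + x 0 * (ε ^ 2 * Real.exp s) := by
      field_simp
      ring
    rw [this]
    have : 0 ≤ x 1 / ε := by positivity
    have : 0 ≤ x 0 * (ε ^ 2 * Real.exp s) := by positivity
    linarith
  rw [abs_le]
  constructor
  · linarith [neg_abs_le (Real.log (x 0)), abs_nonneg (Real.log K)]
  · linarith [le_abs_self (Real.log K), abs_nonneg (Real.log (x 0))]

/-- Here the logarithm is l plus a bounded term, so both tails of l matter. -/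
theorem exists_abs_log_le_of_eq_zero {ε : ℝ} (hε : 0 < ε) {x : Fin 2 → ℝ} (hx0 : x 0 = 0)
    (hx1 : 0 < x 1) :
    ∃ C : ℝ, ∀ l t, |Real.log (x 0 + ε * x 1 * Real.exp (l + logMap ε t))| ≤ C + |l| := by
  refine ⟨|Real.log (ε * x 1)| + |Real.log (ε ^ 2)|, fun l t => ?_⟩
  have := (boundedContraction_logMap hε).bound t
  rw [hx0, zero_add, Real.log_mul (by positivity) (Real.exp_pos _).ne', Real.log_exp]
  refine (abs_add_le _ _).trans ?_
  have := abs_add_le l (logMap ε t)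
  linarith

/-! ### Comparison with the series -/

/-- Discarding the denominator leaves x_n ≤ z_n(1 + x_{n+1}) for the backward limits of the shifted
sequences. Unrolling gives partial sums of the series plus a remainder. -/
theorem exp_backwardLim_le_X0 {ε : ℝ} (hε : 0 < ε) {z : ℕ → ℝ} (hz : ∀ k, 0 < z k)
    (hs : Summable fun n : ℕ => ∏ k ∈ Finset.range (n + 1), z k) :
    Real.exp (backwardLim (logMap ε) fun k => Real.log (z k)) ≤ X0 z := by
  have hφ := boundedContraction_logMap hε
  set X : ℕ → ℝ := fun n => backwardLim (logMap ε) fun k => Real.log (z (k + n)) with hX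
  have hrec : ∀ n, X n = Real.log (z n) + logMap ε (X (n + 1)) := fun n => by
    rw [hX]
    simp only
    rw [hφ.backwardLim_eq]
    simp only [zero_add, add_right_comm _ 1 n, add_assoc]
  have hstep : ∀ n, Real.exp (X n) ≤ z n * (1 + Real.exp (X (n + 1))) := fun n => by
    rw [hrec n, Real.exp_add, Real.exp_log (hz n)]
    exact mul_le_mul_of_nonneg_left (exp_logMap_le _ _) (hz n).le
  have hbd : ∀ n, Real.exp (X n) ≤ z n * Real.exp |Real.log (ε ^ 2)| := fun n => by
    rw [hrec n, Real.exp_add, Real.exp_log (hz n)]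
    exact mul_le_mul_of_nonneg_left
      (Real.exp_le_exp.2 ((le_abs_self _).trans (hφ.bound _))) (hz n).le
  have hpos : ∀ n, 0 < ∏ k ∈ Finset.range n, z k := fun n => Finset.prod_pos fun k _ => hz k
  have hind : ∀ N, Real.exp (X 0) ≤ ∑ n ∈ Finset.range N, ∏ k ∈ Finset.range (n + 1), z k
      + (∏ k ∈ Finset.range N, z k) * Real.exp (X N) := by
    intro N
    induction N with
    | zero => simp
    | succ N ih =>
      have := mul_le_mul_of_nonneg_left (hstep N) (hpos N).le
      rw [Finset.sum_range_succ, Finset.prod_range_succ (n := N)]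
      linarith
  -- As φ is bounded, the remainder is at most a constant times the next term of the series, hence
  -- tends to 0.
  have hle : ∀ N, Real.exp (X 0) ≤ ∑ n ∈ Finset.range N, ∏ k ∈ Finset.range (n + 1), z k
      + (∏ k ∈ Finset.range (N + 1), z k) * Real.exp |Real.log (ε ^ 2)| := by
    intro N
    refine (hind N).trans (add_le_add le_rfl ?_)
    rw [Finset.prod_range_succ, mul_assoc]
    exact mul_le_mul_of_nonneg_left (hbd N) (hpos N).le
  have ht := hs.hasSum.tendsto_sum_nat.add
    (hs.tendsto_atTop_zero.mul_const (Real.exp |Real.log (ε ^ 2)|))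
  rw [zero_mul, add_zero] at ht
  exact ge_of_tendsto' ht hle

/-! ### Auxiliary bounds, and norms on nonnegative matrices -/

theorem tendsto_div_add_one_zero (C : ℝ) :
    Tendsto (fun n : ℕ => C / ((n : ℝ) + 1)) atTop (𝓝 0) := by
  simpa [div_eq_mul_inv] using (tendsto_one_div_add_atTop_nhds_zero_nat (𝕜 := ℝ)).const_mul C

theorem logIncr_le (ε l : ℝ) : logIncr ε l ≤ Real.log (1 + ε ^ 2) + max l 0 := by
  rw [logIncr, Real.log_le_iff_le_exp (by positivity), Real.exp_add, Real.exp_log (by positivity)]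
  have h1 : 1 ≤ Real.exp (max l 0) := Real.one_le_exp (le_max_right _ _)
  have h2 : Real.exp l ≤ Real.exp (max l 0) := Real.exp_le_exp.2 (le_max_left _ _)
  nlinarith [mul_le_mul_of_nonneg_left h2 (sq_nonneg ε)]

/-- Two norms on `2 × 2` matrices are comparable on nonnegative matrices: comparison of an
arbitrary norm with the sum of the entries. -/
theorem exists_seminorm_sandwich (N : Seminorm ℝ (Matrix (Fin 2) (Fin 2) ℝ))
    (hN : ∀ A, N A = 0 → A = 0) :
    ∃ a b : ℝ, 0 < a ∧ 0 < b ∧ ∀ A : Matrix (Fin 2) (Fin 2) ℝ, (∀ i j, 0 ≤ A i j) →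
      0 < (1 : Fin 2 → ℝ) ⬝ᵥ A.mulVec 1 →
      a * ((1 : Fin 2 → ℝ) ⬝ᵥ A.mulVec 1) ≤ N A ∧ N A ≤ b * ((1 : Fin 2 → ℝ) ⬝ᵥ A.mulVec 1) := by
  -- A seminorm is convex, hence continuous in finite dimension. Its extrema on the compact set of
  -- nonnegative matrices of entry sum 1 are the constants.
  have hcont : Continuous fun v : Fin 2 → Fin 2 → ℝ => N (Matrix.of v) := by
    have hc : ConvexOn ℝ Set.univ fun v : Fin 2 → Fin 2 → ℝ => N (Matrix.of v) :=
      ⟨convex_univ, fun x _ y _ s t hs ht hst => N.convexOn.2 (Set.mem_univ _) (Set.mem_univ _)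
        hs ht hst⟩
    exact continuousOn_univ.1 (hc.continuousOn isOpen_univ)
  set σ : (Fin 2 → Fin 2 → ℝ) → ℝ := fun v => (1 : Fin 2 → ℝ) ⬝ᵥ (Matrix.of v).mulVec 1 with hσ
  have hσe : ∀ v, σ v = v 0 0 + v 0 1 + (v 1 0 + v 1 1) := fun v => by
    simp [hσ, dotProduct, Matrix.mulVec, Fin.sum_univ_two]
  have hσc : Continuous σ := by
    have : σ = fun v => v 0 0 + v 0 1 + (v 1 0 + v 1 1) := funext hσe
    rw [this]; fun_prop
  set K : Set (Fin 2 → Fin 2 → ℝ) := Set.Icc 0 1 ∩ {v | σ v = 1} with hK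
  have hKc : IsCompact K :=
    isCompact_Icc.inter_right (isClosed_eq hσc continuous_const)
  have hKne : K.Nonempty := by
    refine ⟨fun _ _ => 1 / 4, ⟨fun _ _ => by simp, fun _ _ => ?_⟩, ?_⟩
    · simp only [Pi.one_apply]; norm_num
    · simp only [Set.mem_ofPred_eq, hσe]; norm_num
  obtain ⟨v, hvK, hv⟩ := hKc.exists_isMinOn hKne hcont.continuousOn
  obtain ⟨w, hwK, hw⟩ := hKc.exists_isMaxOn hKne hcont.continuousOn
  have hvpos : 0 < N (Matrix.of v) := by
    refine lt_of_le_of_ne (apply_nonneg N _) fun h => ?_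
    have h0 := hN _ h.symm
    have h1 : σ v = 1 := hvK.2
    rw [hσ] at h1
    simp only [h0] at h1
    simp at h1
  refine ⟨N (Matrix.of v), N (Matrix.of w), hvpos, hvpos.trans_le (hv hwK), fun A hA hs => ?_⟩
  set s := (1 : Fin 2 → ℝ) ⬝ᵥ A.mulVec 1 with hsdef
  have hsA : s = A 0 0 + A 0 1 + (A 1 0 + A 1 1) := hσe A
  have hmem : (fun i j => s⁻¹ * A i j) ∈ K := by
    refine ⟨⟨fun i j => mul_nonneg (inv_nonneg.2 hs.le) (hA i j), fun i j => ?_⟩, ?_⟩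
    · simp only [Pi.one_apply]
      rw [inv_mul_le_iff₀ hs, mul_one, hsA]
      have := hA 0 0
      have := hA 0 1
      have := hA 1 0
      have := hA 1 1
      fin_cases i <;> fin_cases j <;> simp <;> linarith
    · simp only [Set.mem_ofPred_eq, hσe]
      rw [← mul_add, ← mul_add, ← mul_add, ← hsA]
      exact inv_mul_cancel₀ hs.ne'
  have e : N (Matrix.of fun i j => s⁻¹ * A i j) = s⁻¹ * N A := by
    have : (Matrix.of fun i j => s⁻¹ * A i j) = s⁻¹ • A := by ext i j; simp
    rw [this, map_smul_eq_mul, Real.norm_eq_abs, abs_of_pos (inv_pos.2 hs)]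
  have h1 : N (Matrix.of v) ≤ s⁻¹ * N A := e ▸ hv hmem
  have h2 : s⁻¹ * N A ≤ N (Matrix.of w) := e ▸ hw hmem
  rw [le_inv_mul_iff₀ hs] at h1
  rw [inv_mul_le_iff₀ hs] at h2
  constructor <;> linarith

theorem matProd_nonneg {ε : ℝ} (hε : 0 < ε) {z : ℕ → ℝ} (hz : ∀ k, 0 < z k) (n : ℕ) :
    ∀ i j, 0 ≤ matProd ε z n i j := by
  induction n with
  | zero => intro i j; fin_cases i <;> fin_cases j <;> simp [matProd]
  | succ n ih =>
    intro i j
    have h0 := ih 0 j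
    have h1 := ih 1 j
    have hzn := hz n
    rw [matProd, Matrix.mul_apply, Fin.sum_univ_two]
    fin_cases i
    · simp [mat]; positivity
    · simp [mat]; positivity

section

variable {Ω : Type*} [MeasurableSpace Ω] {P : Measure Ω}

/-! ### Stochastic dominance and convergence of the series -/

theorem stochDom_map_of_ae_le {X Y : Ω → ℝ} (hX : AEMeasurable X P) (hY : AEMeasurable Y P)
    (h : ∀ᵐ ω ∂P, X ω ≤ Y ω) : StochDom (P.map X) (P.map Y) := by
  intro x
  rw [Measure.map_apply_of_aemeasurable hX measurableSet_Ici,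
    Measure.map_apply_of_aemeasurable hY measurableSet_Ici]
  refine measure_mono_ae ?_
  filter_upwards [h] with ω hω hx
  exact le_trans (Set.mem_Ici.1 hx) hω

theorem integrable_max_zero {f : Ω → ℝ} (hf : Measurable f)
    (h : ∫⁻ ω, ENNReal.ofReal (f ω) ∂P < ⊤) : Integrable (fun ω => max (f ω) 0) P := by
  refine ⟨(hf.max measurable_const).aestronglyMeasurable, ?_⟩
  have h0 : 0 ≤ᵐ[P] fun ω => max (f ω) 0 := Eventually.of_forall fun ω => le_max_right _ _
  rw [hasFiniteIntegral_iff_ofReal h0]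
  simpa using h

/-- If `E[L] < 0`, the value `-∞` being allowed, then `E[max L (-K)] < 0` for some `K`. -/
theorem exists_integral_max_neg [IsProbabilityMeasure P] {f : Ω → ℝ} (hf : Measurable f)
    (h : ∫⁻ ω, ENNReal.ofReal (f ω) ∂P < ∫⁻ ω, ENNReal.ofReal (-f ω) ∂P) :
    ∃ K : ℝ, Integrable (fun ω => max (f ω) (-K)) P ∧ ∫ ω, max (f ω) (-K) ∂P < 0 := by
  -- By monotone convergence the truncated negative parts eventually have a mean exceeding that of
  -- the positive part.
  have ht : Tendsto (fun k : ℕ => ∫⁻ ω, ENNReal.ofReal (min (-f ω) k) ∂P) atTop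
      (𝓝 (∫⁻ ω, ENNReal.ofReal (-f ω) ∂P)) := by
    refine lintegral_tendsto_of_tendsto_of_monotone
      (fun k => (hf.neg.min measurable_const).ennreal_ofReal.aemeasurable)
      (Eventually.of_forall fun ω i j hij => ENNReal.ofReal_le_ofReal
        (min_le_min le_rfl (by exact_mod_cast hij))) (Eventually.of_forall fun ω => ?_)
    refine tendsto_const_nhds.congr' ?_
    filter_upwards [eventually_ge_atTop ⌈-f ω⌉₊] with k hk
    rw [min_eq_left (Nat.ceil_le.1 hk)]
  obtain ⟨k, hk⟩ := (ht.eventually (lt_mem_nhds h)).exists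
  have hk0 : (0 : ℝ) ≤ k := Nat.cast_nonneg k
  have hi : Integrable (fun ω => max (f ω) (-(k : ℝ))) P := by
    have hB : Integrable (fun ω => max (f ω) 0 + (k : ℝ)) P :=
      (integrable_max_zero hf (h.trans_le le_top)).add (integrable_const (k : ℝ))
    refine hB.mono' (hf.max measurable_const).aestronglyMeasurable
      (Eventually.of_forall fun ω => ?_)
    rw [Real.norm_eq_abs, abs_le]
    constructor
    · linarith [le_max_right (f ω) (-(k : ℝ)), le_max_right (f ω) 0]
    · exact max_le (by linarith [le_max_left (f ω) 0]) (by linarith [le_max_right (f ω) 0])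
  refine ⟨k, hi, ?_⟩
  rw [integral_eq_lintegral_pos_part_sub_lintegral_neg_part hi, sub_neg]
  have e1 : ∀ ω, ENNReal.ofReal (max (f ω) (-(k : ℝ))) = ENNReal.ofReal (f ω) := fun ω => by
    rcases le_total (-(k : ℝ)) (f ω) with hle | hle
    · rw [max_eq_left hle]
    · rw [max_eq_right hle, ENNReal.ofReal_of_nonpos (by linarith),
        ENNReal.ofReal_of_nonpos (by linarith)]
  have e2 : ∀ ω, -max (f ω) (-(k : ℝ)) = min (-f ω) k := fun ω => by
    rw [← min_neg_neg, neg_neg]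
  simp only [e1, e2]
  refine ENNReal.toReal_strict_mono (ne_of_lt ?_) hk
  refine (lintegral_mono fun ω =>
    ENNReal.ofReal_le_ofReal (min_le_right (-f ω) (k : ℝ))).trans_lt ?_
  simp

/-- The truncated increments have a finite mean e < 0, so by the strong law the product of n factors
is eventually at most exp(ne/2). -/
theorem IsIIDSeq.ae_summable_prod_exp [IsProbabilityMeasure P] {L : ℕ → Ω → ℝ}
    (hL : IsIIDSeq P L)
    (h : ∫⁻ ω, ENNReal.ofReal (L 0 ω) ∂P < ∫⁻ ω, ENNReal.ofReal (-L 0 ω) ∂P) :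
    ∀ᵐ ω ∂P, Summable fun n : ℕ => ∏ k ∈ Finset.range (n + 1), Real.exp (L k ω) := by
  obtain ⟨K, hi, hneg⟩ := exists_integral_max_neg (hL.measurable 0) h
  have hm : Measurable fun l : ℝ => max l (-K) := measurable_id.max measurable_const
  have hlaw := strong_law_ae_real (fun n ω => max (L n ω) (-K)) hi
    (fun i j hij => (hL.indep.indepFun hij).comp hm hm) (fun i => (hL.ident i).comp hm)
  set e := ∫ ω, max (L 0 ω) (-K) ∂P
  filter_upwards [hlaw] with ω hω
  refine (summable_nat_add_iff (f := fun n => ∏ k ∈ Finset.range n, Real.exp (L k ω)) 1).2 ?_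
  have hr : Real.exp (e / 2) < 1 := by
    rw [← Real.exp_zero]; exact Real.exp_lt_exp.2 (by linarith)
  refine Summable.of_norm_bounded_eventually_nat
    (summable_geometric_of_lt_one (Real.exp_pos _).le hr) ?_
  filter_upwards [hω.eventually (gt_mem_nhds (show e < e / 2 by linarith)),
    eventually_gt_atTop 0] with n hn hn0
  have hn' : (0 : ℝ) < n := by exact_mod_cast hn0
  rw [div_lt_iff₀ hn'] at hn
  rw [Real.norm_eq_abs, abs_of_nonneg (Finset.prod_nonneg fun k _ => (Real.exp_pos _).le),
    ← Real.exp_sum, ← Real.exp_nat_mul, Real.exp_le_exp]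
  have : ∑ k ∈ Finset.range n, L k ω ≤ ∑ k ∈ Finset.range n, max (L k ω) (-K) :=
    Finset.sum_le_sum fun k _ => le_max_left _ _
  linarith

/-! ### Growth of the entries and of norms -/

theorem measurable_growth {Z : ℕ → Ω → ℝ} (hZ : ∀ n, Measurable (Z n)) (ε : ℝ) (x y : Fin 2 → ℝ)
    (n : ℕ) : Measurable fun ω => growth ε x y (fun k => Z k ω) n := by
  have h : ∀ n i, Measurable fun ω => ((matProd ε (fun k => Z k ω) n).mulVec y) i := by
    intro n
    induction n with
    | zero => intro i; simp only [matProd]; exact measurable_const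
    | succ n ih =>
      intro i
      have h0 := ih 0
      have h1 := ih 1
      have hz := hZ n
      simp only [matProd_succ]
      fin_cases i
      · simp only [Fin.zero_eta, Matrix.cons_val_zero]; fun_prop
      · simp only [Fin.mk_one, Matrix.cons_val_one, Matrix.cons_val_fin_one]; fun_prop
  unfold growth
  simp only [dotProduct, Fin.sum_univ_two]
  have h0 := h n 0
  have h1 := h n 1
  exact (Real.measurable_log.comp ((h0.const_mul _).add (h1.const_mul _))).const_mul _

/-- Growth of the entries of the products, given a bound of the logarithm of the last factor. -/
theorem growth_of_abs_log_le [IsProbabilityMeasure P] {Z : ℕ → Ω → ℝ} (hZ : ∀ n, Measurable (Z n))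
    (hpos : ∀ᵐ ω ∂P, ∀ k, 0 < Z k ω) (hL : IsIIDSeq P fun n ω => Real.log (Z n ω))
    {ε : ℝ} (hε : 0 < ε) (hψ : Integrable (fun ω => logIncr ε (Real.log (Z 0 ω))) P)
    {ρ : Measure ℝ} [IsProbabilityMeasure ρ]
    (hρ : IsStationary (P.map fun ω => Real.log (Z 0 ω)) (logMap ε) ρ)
    {x y : Fin 2 → ℝ} (hx : 0 ≤ x) (hx0 : x ≠ 0) (hy : 0 ≤ y) (hy0 : y ≠ 0) {G : ℝ → ℝ} {C : ℝ}
    (hGm : Measurable G) (hGi : Integrable (fun ω => G (Real.log (Z 0 ω))) P)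
    (hG : ∀ l t, |Real.log (x 0 + ε * x 1 * Real.exp (l + logMap ε t))| ≤ C + G l) :
    (∀ᵐ ω ∂P, Tendsto (growth ε x y fun k => Z k ω) atTop (𝓝 (∫ t, logIncr ε t ∂ρ))) ∧
    (∀ n : ℕ, Integrable (fun ω => growth ε x y (fun k => Z k ω) n) P) ∧
    Tendsto (fun n : ℕ => eLpNorm (fun ω => growth ε x y (fun k => Z k ω) n
      - ∫ t, logIncr ε t ∂ρ) 1 P) atTop (𝓝 0) := by
  have hφ := boundedContraction_logMap hε
  have ho := isObservable_logIncr ε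
  obtain ⟨C', hC'⟩ := exists_abs_log_sub_sum_le hε hx hx0 hy hy0 hG
  set Λ := ∫ t, logIncr ε t ∂ρ
  set S : ℕ → Ω → ℝ := fun n ω => (∑ k ∈ Finset.range n,
    logIncr ε (orbit (logMap ε) (fun i => Real.log (Z i ω)) 0 k)) / n with hS
  have hSae : ∀ᵐ ω ∂P, Tendsto (fun n => S n ω) atTop (𝓝 Λ) :=
    ho.ae_tendsto_average hφ hL hψ hρ
  have hS1 : Tendsto (fun n => ∫ ω, |S n ω - Λ| ∂P) atTop (𝓝 0) :=
    ho.tendsto_integral_average hφ hL hψ hρ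
  have hSi : ∀ n, Integrable (S n) P := fun n =>
    (integrable_finsetSum _ fun k _ => by
      simpa only [zero_add] using ho.integrable_orbit hφ hL hψ 0 k).div_const _
  have hGn : ∀ n, Integrable (fun ω => G (Real.log (Z n ω))) P := fun n =>
    ((hL.ident n).comp hGm).integrable_iff.2 hGi
  have hGe : ∀ n, ∫ ω, G (Real.log (Z n ω)) ∂P = ∫ ω, G (Real.log (Z 0 ω)) ∂P := fun n =>
    ((hL.ident n).comp hGm).integral_eq
  have hR : ∀ n : ℕ, Integrable (fun ω => (C' + G (Real.log (Z n ω))) / ((n : ℝ) + 1)) P :=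
    fun n => ((integrable_const C').add (hGn n)).div_const _
  have hdist : ∀ n : ℕ, ∀ᵐ ω ∂P, |growth ε x y (fun k => Z k ω) (n + 1) - S (n + 1) ω|
      ≤ (C' + G (Real.log (Z n ω))) / ((n : ℝ) + 1) := by
    intro n
    filter_upwards [hpos] with ω hω
    have hn : (0 : ℝ) < (n : ℝ) + 1 := by positivity
    have := hC' (fun k => Z k ω) hω n
    rw [growth, hS]
    simp only
    push_cast
    rw [one_div_mul_eq_div, ← sub_div, abs_div, abs_of_pos hn]
    exact div_le_div_of_nonneg_right this hn.le
  have hint : ∀ n : ℕ, Integrable (fun ω => growth ε x y (fun k => Z k ω) n) P := by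
    intro n
    cases n with
    | zero => simp [growth]
    | succ n =>
      have hB : Integrable (fun ω => |S (n + 1) ω|
          + (C' + G (Real.log (Z n ω))) / ((n : ℝ) + 1)) P := (hSi (n + 1)).abs.add (hR n)
      refine hB.mono' (measurable_growth hZ ε x y (n + 1)).aestronglyMeasurable ?_
      filter_upwards [hdist n] with ω hω
      rw [Real.norm_eq_abs]
      have := abs_sub_abs_le_abs_sub (growth ε x y (fun k => Z k ω) (n + 1)) (S (n + 1) ω)
      linarith
  refine ⟨?_, hint, ?_⟩
  · filter_upwards [hSae, hL.tendsto_div_zero hGm hGi, ae_all_iff.2 hdist] with ω h1 h2 h3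
    rw [← tendsto_add_atTop_iff_nat 1]
    have hz : Tendsto (fun n : ℕ => growth ε x y (fun k => Z k ω) (n + 1) - S (n + 1) ω) atTop
        (𝓝 0) := by
      refine squeeze_zero_norm (fun n => (Real.norm_eq_abs _).trans_le (h3 n)) ?_
      simpa [add_div] using (tendsto_div_add_one_zero C').add h2
    simpa using hz.add ((tendsto_add_atTop_iff_nat 1).2 h1)
  · rw [← tendsto_add_atTop_iff_nat 1]
    have e : ∀ n : ℕ, eLpNorm (fun ω => growth ε x y (fun k => Z k ω) n - Λ) 1 P
        = ENNReal.ofReal (∫ ω, |growth ε x y (fun k => Z k ω) n - Λ| ∂P) := fun n => by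
      rw [eLpNorm_one_eq_lintegral_enorm]
      exact (ofReal_integral_norm_eq_lintegral_enorm ((hint n).sub (integrable_const Λ))).symm
    simp only [e]
    rw [← ENNReal.ofReal_zero]
    refine ENNReal.tendsto_ofReal ?_
    -- Triangle inequality through the Birkhoff average; the mean of G(log Z_n) does not depend on
    -- n, so division by n + 1 removes it.
    have hupper : ∀ n : ℕ, ∫ ω, |growth ε x y (fun k => Z k ω) (n + 1) - Λ| ∂P
        ≤ (C' + ∫ ω, G (Real.log (Z 0 ω)) ∂P) / ((n : ℝ) + 1) + ∫ ω, |S (n + 1) ω - Λ| ∂P := by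
      intro n
      have hSabs : Integrable (fun ω => |S (n + 1) ω - Λ|) P :=
        ((hSi (n + 1)).sub (integrable_const Λ)).abs
      have e2 : (C' + ∫ ω, G (Real.log (Z 0 ω)) ∂P) / ((n : ℝ) + 1)
          = ∫ ω, (C' + G (Real.log (Z n ω))) / ((n : ℝ) + 1) ∂P := by
        rw [integral_div, integral_add (integrable_const C') (hGn n), hGe n]
        simp
      rw [e2, ← integral_add (hR n) hSabs]
      refine integral_mono_ae ((hint (n + 1)).sub (integrable_const Λ)).abs
        ((hR n).add hSabs) ?_
      filter_upwards [hdist n] with ω hω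
      exact (abs_sub_le _ (S (n + 1) ω) _).trans (add_le_add hω le_rfl)
    refine squeeze_zero (fun n => integral_nonneg fun ω => abs_nonneg _) hupper ?_
    simpa using (tendsto_div_add_one_zero _).add ((tendsto_add_atTop_iff_nat 1).2 hS1)

/-- ⟨1, A1⟩ is the sum of the entries, comparable to any norm on nonnegative matrices; the bounded
difference of logarithms disappears after division by n. -/
theorem isLyapunovExponent_of_growth {Z : ℕ → Ω → ℝ} (hpos : ∀ᵐ ω ∂P, ∀ k, 0 < Z k ω)
    {ε Λ : ℝ} (hε : 0 < ε)
    (h : ∀ᵐ ω ∂P, Tendsto (growth ε 1 1 fun k => Z k ω) atTop (𝓝 Λ)) :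
    IsLyapunovExponent P Z ε Λ := by
  intro N hN
  obtain ⟨a, b, ha, hb, hab⟩ := exists_seminorm_sandwich N hN
  filter_upwards [hpos, h] with ω hω hlim
  set z : ℕ → ℝ := fun k => Z k ω
  have hs : ∀ n, 0 < (1 : Fin 2 → ℝ) ⬝ᵥ (matProd ε z n).mulVec 1 := by
    intro n
    have hv : ∀ i, 0 < ((matProd ε z n).mulVec 1) i := by
      induction n with
      | zero => intro i; simp [matProd]
      | succ n ih =>
        intro i
        have h0 := ih 0
        have h1 := ih 1
        have hzn : 0 < z n := hω n
        rw [matProd_succ]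
        fin_cases i
        · simp only [Fin.zero_eta, Matrix.cons_val_zero]; positivity
        · simp only [Fin.mk_one, Matrix.cons_val_one, Matrix.cons_val_fin_one]; positivity
    rw [dotProduct, Fin.sum_univ_two]
    simp only [Pi.one_apply, one_mul]
    linarith [hv 0, hv 1]
  have hz : Tendsto (fun n : ℕ => 1 / (n : ℝ) * Real.log (N (matProd ε z n)) - growth ε 1 1 z n)
      atTop (𝓝 0) := by
    refine squeeze_zero_norm (fun n => ?_)
      (tendsto_const_div_atTop_nhds_zero_nat (|Real.log a| + |Real.log b|))
    have hn := hab _ (matProd_nonneg hε hω n) (hs n)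
    have := abs_log_sub_log_le ha hb (hs n) hn.1 hn.2
    rw [growth, ← mul_sub, Real.norm_eq_abs, abs_mul, abs_of_nonneg (by positivity),
      one_div_mul_eq_div]
    exact div_le_div_of_nonneg_right this (Nat.cast_nonneg n)
  simpa using hz.add hlim

end

/-- The law of X_0 is a `Measure.map`, which is zero by convention for a function that is not a.e.
measurable. -/
theorem IsIIDSeq.aemeasurable_X0 {Ω : Type*} [MeasurableSpace Ω] {P : Measure Ω} {Z : ℕ → Ω → ℝ}
    (hZ : IsIIDSeq P Z)
    (hs : ∀ᵐ ω ∂P, Summable fun n : ℕ => ∏ k ∈ Finset.range (n + 1), Z k ω) :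
    AEMeasurable (fun ω => X0 fun k => Z k ω) P := by
  have hm : ∀ N : ℕ, Measurable fun ω =>
      ∑ n ∈ Finset.range N, ∏ k ∈ Finset.range (n + 1), Z k ω := fun N =>
    Finset.measurable_fun_sum _ fun n _ => Finset.measurable_fun_prod _ fun k _ => hZ.measurable k
  refine aemeasurable_of_tendsto_metrizable_ae atTop (fun N => (hm N).aemeasurable) ?_
  filter_upwards [hs] with ω hω
  exact hω.hasSum.tendsto_sum_nat

end RandomMatrix

end

open RandomMatrix

/-! ### The theorem -/

theorem lemma2p2 {Ω : Type*} [MeasurableSpace Ω] (P : Measure Ω) [IsProbabilityMeasure P]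
    (Z : ℕ → Ω → ℝ) (hZm : ∀ n, Measurable (Z n)) (hZindep : iIndepFun Z P)
    (hZident : ∀ n, IdentDistrib (Z n) (Z 0) P P) (hZ : RandomMatrix.Assumptions P (Z 0))
    (ε : ℝ) (hε : 0 < ε) :
    -- existence and uniqueness of the law of `X_ε`
    (∃! ν : Measure ℝ, RandomMatrix.IsInvariantLaw (P.map (Z 0)) ε ν) ∧
    -- the series defining `X_0` converges
    (∀ᵐ ω ∂P, Summable (fun n : ℕ => ∏ k ∈ Finset.range (n + 1), Z k ω)) ∧
    ∀ ν : Measure ℝ, RandomMatrix.IsInvariantLaw (P.map (Z 0)) ε ν →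
      (ε ≤ 1 → RandomMatrix.StochDom (P.map (Z 0)) ν) ∧
      RandomMatrix.StochDom ν (P.map (fun ω => RandomMatrix.X0 (fun k => Z k ω))) ∧
      -- the Lyapunov exponent exists and equals `E[log (1 + ε² X_ε)]`
      Integrable (fun x : ℝ => Real.log (1 + ε ^ 2 * x)) ν ∧
      RandomMatrix.IsLyapunovExponent P Z ε (∫ x, Real.log (1 + ε ^ 2 * x) ∂ν) ∧
      -- growth rate of the entries, almost surely and in `L¹`
      ∀ x y : Fin 2 → ℝ, 0 ≤ x → 0 ≤ y → x ≠ 0 → y ≠ 0 →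
        (0 < x 0 ∨ Integrable (fun ω => Real.log (Z 0 ω)) P) →
        (∀ᵐ ω ∂P, Tendsto (RandomMatrix.growth ε x y (fun k => Z k ω)) atTop
          (𝓝 (∫ x, Real.log (1 + ε ^ 2 * x) ∂ν))) ∧
        (∀ n : ℕ, Integrable (fun ω => RandomMatrix.growth ε x y (fun k => Z k ω) n) P) ∧
        Tendsto (fun n : ℕ => eLpNorm (fun ω => RandomMatrix.growth ε x y (fun k => Z k ω) n
          - ∫ x, Real.log (1 + ε ^ 2 * x) ∂ν) 1 P) atTop (𝓝 0) := by
  have hZs : IsIIDSeq P Z := ⟨hZm, hZindep, hZident⟩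
  have hL : IsIIDSeq P fun n ω => Real.log (Z n ω) :=
    ⟨fun n => Real.measurable_log.comp (hZm n),
      hZindep.comp (fun _ => Real.log) fun _ => Real.measurable_log,
      fun n => (hZident n).comp Real.measurable_log⟩
  have hpos : ∀ᵐ ω ∂P, ∀ k, 0 < Z k ω :=
    ae_all_iff.2 fun k => (hZident k).symm.ae_snd (p := fun x => 0 < x) measurableSet_Ioi hZ.pos
  have hμprob : IsProbabilityMeasure (P.map (Z 0)) :=
    Measure.isProbabilityMeasure_map (hZm 0).aemeasurable
  have hμpos : ∀ᵐ x ∂(P.map (Z 0)), 0 < x :=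
    (ae_map_iff (hZm 0).aemeasurable measurableSet_Ioi).2 hZ.pos
  have hμlog : (P.map (Z 0)).map Real.log = P.map fun ω => Real.log (Z 0 ω) :=
    Measure.map_map Real.measurable_log (hZm 0)
  have hφ := boundedContraction_logMap hε
  have hTm : Measurable fun ω => backwardLim (logMap ε) fun k => Real.log (Z k ω) :=
    hφ.measurable_backwardLim.comp hL.measurable_seq_zero
  have hstat := hL.isStationary_backwardLim hφ
  set ρ := P.map fun ω => backwardLim (logMap ε) fun k => Real.log (Z k ω) with hρ
  have hρprob : IsProbabilityMeasure ρ := Measure.isProbabilityMeasure_map hTm.aemeasurable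
  have hinv : IsInvariantLaw (P.map (Z 0)) ε (ρ.map Real.exp) :=
    isInvariantLaw_map_exp hε hμpos (hμlog ▸ hstat)
  have huniq : ∀ ν, IsInvariantLaw (P.map (Z 0)) ε ν → ν = ρ.map Real.exp := by
    intro ν hν
    have := hν.prob
    have := Measure.isProbabilityMeasure_map Real.measurable_log.aemeasurable (μ := ν)
    have h := hν.isStationary hε hμpos
    rw [hμlog] at h
    rw [← hL.stationary_unique hφ h hstat, map_exp_map_log (hν.ae_pos hμpos)]
  have hsum : ∀ᵐ ω ∂P, Summable fun n : ℕ => ∏ k ∈ Finset.range (n + 1), Z k ω := by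
    filter_upwards [hL.ae_summable_prod_exp hZ.log_neg, hpos] with ω hω hp
    simpa only [Real.exp_log (hp _)] using hω
  -- E[log⁺ Z] is finite, being strictly smaller than an element of [0, ∞].
  have hψ : Integrable (fun ω => logIncr ε (Real.log (Z 0 ω))) P := by
    have hB : Integrable (fun ω => Real.log (1 + ε ^ 2) + max (Real.log (Z 0 ω)) 0) P :=
      (integrable_const _).add
        (integrable_max_zero (hL.measurable 0) (hZ.log_neg.trans_le le_top))
    refine hB.mono' ((isObservable_logIncr ε).measurable.comp
      (hL.measurable 0)).aestronglyMeasurable (Eventually.of_forall fun ω => ?_)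
    rw [Real.norm_eq_abs, abs_of_nonneg ((isObservable_logIncr ε).nonneg _)]
    exact logIncr_le _ _
  have hψρ : Integrable (logIncr ε) ρ := by
    have := Measure.isProbabilityMeasure_map (hL.measurable 0).aemeasurable (μ := P)
    exact (isObservable_logIncr ε).integrable_stationary hφ hstat
      ((integrable_map_measure (isObservable_logIncr ε).measurable.aestronglyMeasurable
        (hL.measurable 0).aemeasurable).2 hψ)
  have hlogm : Measurable fun x : ℝ => Real.log (1 + ε ^ 2 * x) := by fun_prop
  refine ⟨⟨_, hinv, huniq⟩, hsum, fun ν hν => ?_⟩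
  obtain rfl := huniq ν hν
  have hX : ρ.map Real.exp
      = P.map fun ω => Real.exp (backwardLim (logMap ε) fun k => Real.log (Z k ω)) :=
    Measure.map_map Real.measurable_exp hTm
  have hΛ : ∫ x, Real.log (1 + ε ^ 2 * x) ∂(ρ.map Real.exp) = ∫ t, logIncr ε t ∂ρ :=
    integral_map Real.measurable_exp.aemeasurable hlogm.aestronglyMeasurable
  have hgrowth : ∀ x y : Fin 2 → ℝ, 0 ≤ x → 0 ≤ y → x ≠ 0 → y ≠ 0 →
      (0 < x 0 ∨ Integrable (fun ω => Real.log (Z 0 ω)) P) →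
      (∀ᵐ ω ∂P, Tendsto (growth ε x y (fun k => Z k ω)) atTop (𝓝 (∫ t, logIncr ε t ∂ρ))) ∧
      (∀ n : ℕ, Integrable (fun ω => growth ε x y (fun k => Z k ω) n) P) ∧
      Tendsto (fun n : ℕ => eLpNorm (fun ω => growth ε x y (fun k => Z k ω) n
        - ∫ t, logIncr ε t ∂ρ) 1 P) atTop (𝓝 0) := by
    intro x y hx hy hx0 hy0 hor
    by_cases h0 : 0 < x 0
    · obtain ⟨C, hC⟩ := exists_abs_log_le_of_pos hε hx h0
      exact growth_of_abs_log_le hZm hpos hL hε hψ hstat hx hx0 hy hy0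
        (isObservable_logIncr ε).measurable hψ hC
    · have hx00 : x 0 = 0 := le_antisymm (not_lt.1 h0) (hx 0)
      have hx1 : 0 < x 1 := by
        refine lt_of_le_of_ne (hx 1) fun h => hx0 (funext fun i => ?_)
        fin_cases i
        · exact hx00
        · exact h.symm
      obtain ⟨C, hC⟩ := exists_abs_log_le_of_eq_zero hε hx00 hx1
      exact growth_of_abs_log_le hZm hpos hL hε hψ hstat hx hx0 hy hy0
        continuous_abs.measurable (hor.resolve_left h0).abs hC
  rw [hΛ]
  refine ⟨fun h1 => ?_, ?_, ?_, ?_, hgrowth⟩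
  · rw [hX]
    refine stochDom_map_of_ae_le (hZm 0).aemeasurable
      (Real.measurable_exp.comp hTm).aemeasurable ?_
    filter_upwards [hpos] with ω hω
    -- In this coupling X_ε is Z_1 times the exponential of a value of φ, which is nonnegative for ε
    -- ≤ 1.
    rw [hφ.backwardLim_eq, Real.exp_add, Real.exp_log (hω 0)]
    exact le_mul_of_one_le_right (hω 0).le (Real.one_le_exp (logMap_nonneg hε h1 _))
  · rw [hX]
    refine stochDom_map_of_ae_le (Real.measurable_exp.comp hTm).aemeasurable
      (hZs.aemeasurable_X0 hsum) ?_
    filter_upwards [hpos, hsum] with ω hω hs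
    exact exp_backwardLim_le_X0 hε hω hs
  · exact (integrable_map_measure hlogm.aestronglyMeasurable
      Real.measurable_exp.aemeasurable).2 hψρ
  -- The vector (1, 1) has a positive first coordinate, so integrability of log Z is not needed.
  · refine isLyapunovExponent_of_growth hpos hε (hgrowth 1 1 zero_le_one zero_le_one one_ne_zero
      one_ne_zero (Or.inl ?_)).1
    simp
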